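/- Let $k$ be a field of characteristic zero and $n\ge 1$. Let $V=\{v\in k^{n+1}:\sum_i v_i=0\}$ be the geometric representation of the symmetric group $S_{n+1}$ (permuting coordinates); for a transposition $t$ let $H_t\subset V$ be its reflecting hyperplane, and for $1\le i\le n$ let $s_i=(i,i+1)$. A Weyl line is a one-dimensional subspace of $V$ which is an intersection of reflecting hyperplanes (the empty intersection being $V$). Let $Z\subset V$ be the union of all Weyl lines and $V_i\subset Z$ the union of those not contained in $H_{s_i}$. For a subset $X\subset V$ that is a closed cone, $\mathcal O(X)$ denotes the algebra of regular (polynomial) functions on $X$, $\mathbb Z$-graded with the restrictions of linear forms in degree $2$. Put $\bar R=\mathcal O(Z)$ and $R_i=\mathcal O(V_i)$; since $V_i$ is $s_i$-stable, $s_i$ acts on $R_i$, and $R_i^{s_i}$ denotes the graded subalgebra of invariants. Graded $(\bar R,\bar R)$-bimodules are $\mathbb Z$-graded $\bar R\otimes_k\bar R$-modules, isomorphisms between them are isomorphisms of bimodules that are homogeneous of degree $0$, and $M[s]$ denotes the shift $(M[s])_d=M_{d+s}$. For such bimodules $M,N$ let $V_M^r\subset Z$ and $V_N^\ell\subset Z$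 be the zero loci of the right annihilator of $M$ and of the left annihilator of $N$ in $\bar R$, and put $$M\ast N:=M\otimes_{\bar R}\mathcal O(V_M^r\cap V_N^\ell)\otimes_{\bar R}N,$$ which is again a graded $(\bar R,\bar R)$-bimodule. Let $B_i:=R_i\otimes_{R_i^{s_i}}R_i$, a graded $(\bar R,\bar R)$-bimodule via the restriction map $\bar R\to R_i$. **Theorem.** For all $i,j\in\{1,\dots,n\}$ there are isomorphisms of graded $(\bar R,\bar R)$-bimodules - $(B_j\ast B_i)\ast B_j\cong B_j$ and $B_j\ast(B_i\ast B_j)\cong B_j$ if $|i-j|=1$; - $B_i\ast B_j\cong B_j\ast B_i$ if $|i-j|>1$; - $B_i\ast B_i\cong B_i\oplus B_i[-2]$. -/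

import Mathlib

noncomputable section

namespace TLBimod

open scoped TensorProduct DirectSum

universe u

/-! ### Internal gradings by submodules -/

section Internal

variable {k M P : Type*} [Field k] [AddCommGroup M] [Module k M] [AddCommGroup P] [Module k P]

theorem exists_linearMap {D : ℤ → Submodule k M} (h : DirectSum.IsInternal D)
    (φ : ∀ i, D i →ₗ[k] P) :
    ∃ f : M →ₗ[k] P, ∀ (i : ℤ) (x : M) (hx : x ∈ D i), f x = φ i ⟨x, hx⟩ := by
  let e : (⨁ i, D i) ≃ₗ[k] M := LinearEquiv.ofBijective (DirectSum.coeLinearMap D) h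
  refine ⟨(DirectSum.toModule k ℤ P φ).comp e.symm.toLinearMap, fun i x hx => ?_⟩
  have he : e (DirectSum.lof k ℤ (fun i => D i) i ⟨x, hx⟩) = x :=
    DirectSum.coeLinearMap_of D i ⟨x, hx⟩
  have : e.symm x = DirectSum.lof k ℤ (fun i => D i) i ⟨x, hx⟩ := by
    rw [LinearEquiv.symm_apply_eq, he]
  simp [this]

theorem exists_proj {D : ℤ → Submodule k M} (h : DirectSum.IsInternal D) :
    ∃ p : ℤ → M →ₗ[k] M, (∀ d m, p d m ∈ D d) ∧ (∀ d, ∀ m ∈ D d, p d m = m) ∧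
      ∀ d e, e ≠ d → ∀ m ∈ D e, p d m = 0 := by
  have H : ∀ d : ℤ, ∃ f : M →ₗ[k] M, ∀ (i : ℤ) (x : M) (hx : x ∈ D i),
      f x = (if i = d then (D i).subtype else 0) ⟨x, hx⟩ := fun d =>
    exists_linearMap h fun i => if i = d then (D i).subtype else 0
  choose p hp using H
  refine ⟨p, fun d m => ?_, fun d m hm => by simp [hp d d m hm],
    fun d e hne m hm => by simp [hp d e m hm, hne]⟩
  have hm : m ∈ iSup D := by rw [h.submodule_iSup_eq_top]; trivial
  induction hm using Submodule.iSup_induction' with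
  | mem e x hx =>
    by_cases hed : e = d
    · subst hed; rw [hp e e x hx]; simpa using hx
    · rw [hp d e x hx]; simp [hed]
  | zero => simp
  | add x y _ _ hx hy => rw [map_add]; exact add_mem hx hy

theorem isInternal_of_proj {D : ℤ → Submodule k M} (htop : iSup D = ⊤)
    (p : ℤ → M →ₗ[k] P) (ι : M →ₗ[k] P) (hι : Function.Injective ι)
    (h1 : ∀ d, ∀ m ∈ D d, p d m = ι m)
    (h2 : ∀ d e, e ≠ d → ∀ m ∈ D e, p d m = 0) : DirectSum.IsInternal D := by
  rw [DirectSum.isInternal_submodule_iff_iSupIndep_and_iSup_eq_top]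
  refine ⟨fun d => ?_, htop⟩
  rw [Submodule.disjoint_def]
  intro x hx hx'
  have hle : (⨆ e, ⨆ (_ : e ≠ d), D e) ≤ LinearMap.ker (p d) :=
    iSup₂_le fun e he m hm => h2 d e he m hm
  have h0 : p d x = 0 := hle hx'
  rw [h1 d x hx] at h0
  exact hι (by rw [h0, map_zero])

theorem isInternal_induction {D : ℤ → Submodule k M} (h : DirectSum.IsInternal D)
    {C : M → Prop} (m : M) (hC : ∀ d, ∀ x ∈ D d, C x) (h0 : C 0)
    (hadd : ∀ x y, C x → C y → C (x + y)) : C m := by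
  have hm : m ∈ iSup D := by rw [h.submodule_iSup_eq_top]; trivial
  exact Submodule.iSup_induction D (motive := C) hm hC h0 hadd

theorem exists_sum_proj {D : ℤ → Submodule k M} (h : DirectSum.IsInternal D)
    {p : ℤ → M →ₗ[k] M} (hp1 : ∀ d, ∀ m ∈ D d, p d m = m)
    (hp2 : ∀ d e, e ≠ d → ∀ m ∈ D e, p d m = 0) (a : M) : ∃ s : Finset ℤ, ∑ d ∈ s, p d a = a := by
  have H : ∃ s : Finset ℤ, ∀ t, s ⊆ t → ∑ d ∈ t, p d a = a := by
    refine isInternal_induction h a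
      (C := fun a => ∃ s : Finset ℤ, ∀ t, s ⊆ t → ∑ d ∈ t, p d a = a) ?_ ⟨∅, by simp⟩ ?_
    · intro e x hx
      refine ⟨{e}, fun t ht => ?_⟩
      rw [Finset.sum_eq_single e (fun d _ hd => hp2 d e (Ne.symm hd) x hx)
        (fun h => (h (ht (Finset.mem_singleton_self e))).elim), hp1 e x hx]
    · rintro x y ⟨s, hs⟩ ⟨s', hs'⟩
      refine ⟨s ∪ s', fun t ht => ?_⟩
      simp only [map_add, Finset.sum_add_distrib]
      rw [hs t (Finset.union_subset_left ht), hs' t (Finset.union_subset_right ht)]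
  obtain ⟨s, hs⟩ := H
  exact ⟨s, hs s le_rfl⟩

end Internal

/-! ### Graded commutative algebras and graded bimodules -/

/-- A `ℤ`-graded commutative `k`-algebra. -/
structure GrAlg (k : Type u) [Field k] where
  carrier : Type u
  [commRing : CommRing carrier]
  [algebra : Algebra k carrier]
  deg : ℤ → Submodule k carrier
  [gradedMonoid : SetLike.GradedMonoid deg]
  isInternal : DirectSum.IsInternal deg

attribute [instance] GrAlg.commRing GrAlg.algebra GrAlg.gradedMonoid

/-- A `ℤ`-graded `(A, B)`-bimodule, i.e. a graded module over `A ⊗[k] B`: a `k`-vector space with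
commuting left `A`-action and right `B`-action (`B` is commutative, so a right action is a
homomorphism `B → End M`), and an internal grading compatible with both actions. -/
structure GrBimod {k : Type u} [Field k] (A B : GrAlg k) where
  carrier : Type u
  [addCommGroup : AddCommGroup carrier]
  [module : Module k carrier]
  left : A.carrier →ₐ[k] Module.End k carrier
  right : B.carrier →ₐ[k] Module.End k carrier
  comm : ∀ a b m, left a (right b m) = right b (left a m)
  deg : ℤ → Submodule k carrier
  isInternal : DirectSum.IsInternal deg
  left_mem : ∀ {i j : ℤ} {a : A.carrier} {m : carrier},
    a ∈ A.deg i → m ∈ deg j → left a m ∈ deg (i + j)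
  right_mem : ∀ {i j : ℤ} {b : B.carrier} {m : carrier},
    b ∈ B.deg i → m ∈ deg j → right b m ∈ deg (j + i)

attribute [instance] GrBimod.addCommGroup GrBimod.module

namespace GrBimod

variable {k : Type u} [Field k] {A B C : GrAlg k}

/-- Isomorphism in the category of graded bimodules: a bijective map of bimodules which is
homogeneous of degree zero. -/
def Isomorphic (M N : GrBimod A B) : Prop :=
  ∃ e : M.carrier ≃ₗ[k] N.carrier,
    (∀ a m, e (M.left a m) = N.left a (e m)) ∧
    (∀ b m, e (M.right b m) = N.right b (e m)) ∧
    ∀ d m, e m ∈ N.deg d ↔ m ∈ M.deg d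

/-- The shift `M[s]`, with `M[s]_i = M_{i+s}`. -/
def shift (M : GrBimod A B) (s : ℤ) : GrBimod A B where
  carrier := M.carrier
  left := M.left
  right := M.right
  comm := M.comm
  deg i := M.deg (i + s)
  isInternal := by
    have h := M.isInternal
    rw [DirectSum.isInternal_submodule_iff_iSupIndep_and_iSup_eq_top] at h ⊢
    refine ⟨h.1.comp (add_left_injective s), ?_⟩
    rw [← h.2]
    exact (Equiv.addRight s).iSup_comp (g := M.deg)
  left_mem {i j a m} ha hm := by rw [add_assoc]; exact M.left_mem ha hm
  right_mem {i j a m} ha hm := by rw [add_right_comm]; exact M.right_mem ha hm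

/-- The direct sum of two graded bimodules. -/
def directSum (M N : GrBimod A B) : GrBimod A B where
  carrier := M.carrier × N.carrier
  left := AlgHom.ofLinearMap
    (LinearMap.prodMapLinear k M.carrier N.carrier M.carrier N.carrier k ∘ₗ
      M.left.toLinearMap.prod N.left.toLinearMap)
    (by ext <;> simp) (fun a b => by ext <;> simp)
  right := AlgHom.ofLinearMap
    (LinearMap.prodMapLinear k M.carrier N.carrier M.carrier N.carrier k ∘ₗ
      M.right.toLinearMap.prod N.right.toLinearMap)
    (by ext <;> simp) (fun a b => by ext <;> simp)
  comm a b m := by simp [M.comm, N.comm]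
  deg d := (M.deg d).prod (N.deg d)
  isInternal := by
    obtain ⟨p, hp, hp1, hp2⟩ := exists_proj M.isInternal
    obtain ⟨q, hq, hq1, hq2⟩ := exists_proj N.isInternal
    refine isInternal_of_proj ?_ (fun d => (p d).prodMap (q d)) LinearMap.id
      Function.injective_id ?_ ?_
    · rw [eq_top_iff]
      rintro ⟨x, y⟩ -
      have hx : ((x, 0) : M.carrier × N.carrier) ∈ ⨆ d, (M.deg d).prod (N.deg d) := by
        refine isInternal_induction M.isInternal x (C := fun x =>
          ((x, 0) : M.carrier × N.carrier) ∈ ⨆ d, (M.deg d).prod (N.deg d)) ?_ ?_ ?_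
        · exact fun d x hx => Submodule.mem_iSup_of_mem d ⟨hx, zero_mem _⟩
        · exact zero_mem _
        · intro x x' h h'; simpa using add_mem h h'
      have hy : ((0, y) : M.carrier × N.carrier) ∈ ⨆ d, (M.deg d).prod (N.deg d) := by
        refine isInternal_induction N.isInternal y (C := fun y =>
          ((0, y) : M.carrier × N.carrier) ∈ ⨆ d, (M.deg d).prod (N.deg d)) ?_ ?_ ?_
        · exact fun d x hx => Submodule.mem_iSup_of_mem d ⟨zero_mem _, hx⟩
        · exact zero_mem _
        · intro x x' h h'; simpa using add_mem h h'
      simpa using add_mem hx hy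
    · rintro d ⟨x, y⟩ ⟨hx, hy⟩
      exact Prod.ext (hp1 d x hx) (hq1 d y hy)
    · rintro d e hne ⟨x, y⟩ ⟨hx, hy⟩
      exact Prod.ext (hp2 d e hne x hx) (hq2 d e hne y hy)
  left_mem ha hm := ⟨M.left_mem ha hm.1, N.left_mem ha hm.2⟩
  right_mem ha hm := ⟨M.right_mem ha hm.1, N.right_mem ha hm.2⟩

/-- A graded algebra `C`, viewed as an `(A, B)`-bimodule through degree preserving algebra maps
`f : A → C` and `g : B → C`. -/
def ofAlgHom (C : GrAlg k) (f : A.carrier →ₐ[k] C.carrier) (hf : ∀ d, ∀ a ∈ A.deg d, f a ∈ C.deg d)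
    (g : B.carrier →ₐ[k] C.carrier) (hg : ∀ d, ∀ b ∈ B.deg d, g b ∈ C.deg d) : GrBimod A B where
  carrier := C.carrier
  left := (Algebra.lmul k C.carrier).comp f
  right := (Algebra.lmul k C.carrier).comp g
  comm a b m := by simp [mul_left_comm]
  deg := C.deg
  isInternal := C.isInternal
  left_mem ha hm := SetLike.mul_mem_graded (hf _ _ ha) hm
  right_mem ha hm := by rw [add_comm]; exact SetLike.mul_mem_graded (hg _ _ ha) hm

/-- The underlying space of an `(A, B)`-bimodule, as an `A`-module through the left action. -/
def L (M : GrBimod A B) : Type u := M.carrier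

/-- The underlying space of an `(A, B)`-bimodule, as a `B`-module through the right action. -/
def R (M : GrBimod A B) : Type u := M.carrier

instance (M : GrBimod A B) : AddCommGroup M.L := M.addCommGroup
instance (M : GrBimod A B) : Module k M.L := M.module
instance (M : GrBimod A B) : AddCommGroup M.R := M.addCommGroup
instance (M : GrBimod A B) : Module k M.R := M.module

/-- The identity map to `M.L`. -/
def toL (M : GrBimod A B) : M.carrier ≃ₗ[k] M.L := LinearEquiv.refl k M.carrier

/-- The identity map to `M.R`. -/
def toR (M : GrBimod A B) : M.carrier ≃ₗ[k] M.R := LinearEquiv.refl k M.carrier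

instance (M : GrBimod A B) : Module A.carrier M.L where
  smul a m := M.toL (M.left a (M.toL.symm m))
  one_smul m := LinearMap.congr_fun (map_one M.left) m
  mul_smul a b m := LinearMap.congr_fun (map_mul M.left a b) m
  smul_zero a := map_zero (M.left a)
  smul_add a := map_add (M.left a)
  add_smul a b m := LinearMap.congr_fun (map_add M.left a b) m
  zero_smul m := LinearMap.congr_fun (map_zero M.left) m

instance (M : GrBimod A B) : Module B.carrier M.R where
  smul b m := M.toR (M.right b (M.toR.symm m))
  one_smul m := LinearMap.congr_fun (map_one M.right) m
  mul_smul a b m := LinearMap.congr_fun (map_mul M.right a b) m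
  smul_zero a := map_zero (M.right a)
  smul_add a := map_add (M.right a)
  add_smul a b m := LinearMap.congr_fun (map_add M.right a b) m
  zero_smul m := LinearMap.congr_fun (map_zero M.right) m

theorem smul_toL (M : GrBimod A B) (a : A.carrier) (m : M.carrier) :
    a • M.toL m = M.toL (M.left a m) := rfl

theorem smul_toR (M : GrBimod A B) (b : B.carrier) (m : M.carrier) :
    b • M.toR m = M.toR (M.right b m) := rfl

instance (M : GrBimod A B) : IsScalarTower k A.carrier M.L where
  smul_assoc c a m := LinearMap.congr_fun (map_smul M.left c a) m

instance (M : GrBimod A B) : IsScalarTower k B.carrier M.R where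
  smul_assoc c a m := LinearMap.congr_fun (map_smul M.right c a) m

instance (M : GrBimod A B) : SMulCommClass A.carrier k M.L where
  smul_comm a c m := (M.left a).map_smul c m

instance (M : GrBimod A B) : SMulCommClass B.carrier k M.R where
  smul_comm b c m := (M.right b).map_smul c m

/-- The left action, by maps of right modules. -/
def leftR (M : GrBimod A B) : A.carrier →+* Module.End B.carrier M.R where
  toFun a :=
    { toFun := fun m => M.toR (M.left a (M.toR.symm m))
      map_add' := map_add (M.left a)
      map_smul' := fun b m => M.comm a b m }
  map_one' := LinearMap.ext fun m => LinearMap.congr_fun (map_one M.left) m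
  map_mul' a b := LinearMap.ext fun m => LinearMap.congr_fun (map_mul M.left a b) m
  map_zero' := LinearMap.ext fun m => LinearMap.congr_fun (map_zero M.left) m
  map_add' a b := LinearMap.ext fun m => LinearMap.congr_fun (map_add M.left a b) m

/-- The right action, by maps of left modules. -/
def rightL (M : GrBimod A B) : B.carrier →+* Module.End A.carrier M.L where
  toFun b :=
    { toFun := fun m => M.toL (M.right b (M.toL.symm m))
      map_add' := map_add (M.right b)
      map_smul' := fun a m => (M.comm a b m).symm }
  map_one' := LinearMap.ext fun m => LinearMap.congr_fun (map_one M.right) m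
  map_mul' a b := LinearMap.ext fun m => LinearMap.congr_fun (map_mul M.right a b) m
  map_zero' := LinearMap.ext fun m => LinearMap.congr_fun (map_zero M.right) m
  map_add' a b := LinearMap.ext fun m => LinearMap.congr_fun (map_add M.right a b) m

theorem leftR_toR (M : GrBimod A B) (a : A.carrier) (m : M.carrier) :
    M.leftR a (M.toR m) = M.toR (M.left a m) := rfl

theorem rightL_toL (M : GrBimod A B) (b : B.carrier) (m : M.carrier) :
    M.rightL b (M.toL m) = M.toL (M.right b m) := rfl

/-- The canonical `k`-bilinear map `M × N → M ⊗_B N`. -/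
def tmul (M : GrBimod A B) (N : GrBimod B C) :
    M.carrier →ₗ[k] N.carrier →ₗ[k] M.R ⊗[B.carrier] N.L :=
  LinearMap.mk₂ k (fun m n => M.toR m ⊗ₜ[B.carrier] N.toL n)
    (fun m m' n => by rw [map_add, TensorProduct.add_tmul])
    (fun c m n => by rw [map_smul, TensorProduct.smul_tmul'])
    (fun m n n' => by rw [map_add, TensorProduct.tmul_add])
    (fun c m n => by rw [map_smul, TensorProduct.tmul_smul])

theorem tmul_apply (M : GrBimod A B) (N : GrBimod B C) (m : M.carrier) (n : N.carrier) :
    tmul M N m n = M.toR m ⊗ₜ[B.carrier] N.toL n := rfl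

theorem tmul_balanced (M : GrBimod A B) (N : GrBimod B C) (m : M.carrier) (b : B.carrier)
    (n : N.carrier) : tmul M N (M.right b m) n = tmul M N m (N.left b n) := by
  rw [tmul_apply, tmul_apply, ← smul_toR, ← smul_toL, TensorProduct.smul_tmul]

theorem tens_induction (M : GrBimod A B) (N : GrBimod B C) {P : M.R ⊗[B.carrier] N.L → Prop}
    (t : M.R ⊗[B.carrier] N.L) (h0 : P 0) (hadd : ∀ x y, P x → P y → P (x + y))
    (h : ∀ m n, P (tmul M N m n)) : P t :=
  TensorProduct.induction_on t h0 (fun m n => h m n) hadd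

/-- The degree `d` part of `M ⊗_B N`: the span of the `m ⊗ n` with `m`, `n` homogeneous and
`deg m + deg n = d`. -/
def tensDeg (M : GrBimod A B) (N : GrBimod B C) (d : ℤ) :
    Submodule k (M.R ⊗[B.carrier] N.L) :=
  Submodule.span k {t | ∃ (i j : ℤ) (m : M.carrier) (n : N.carrier),
    m ∈ M.deg i ∧ n ∈ N.deg j ∧ i + j = d ∧ t = M.toR m ⊗ₜ[B.carrier] N.toL n}

theorem tensDeg_tmul (M : GrBimod A B) (N : GrBimod B C) {i j : ℤ} {m : M.carrier} {n : N.carrier}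
    (hm : m ∈ M.deg i) (hn : n ∈ N.deg j) : tmul M N m n ∈ tensDeg M N (i + j) :=
  Submodule.subset_span ⟨i, j, m, n, hm, hn, rfl, rfl⟩

theorem iSup_tensDeg (M : GrBimod A B) (N : GrBimod B C) : iSup (tensDeg M N) = ⊤ := by
  rw [eq_top_iff]
  rintro t -
  refine tens_induction M N t (zero_mem _) (fun x y hx hy => add_mem hx hy) fun m n => ?_
  refine isInternal_induction M.isInternal m
    (C := fun m => tmul M N m n ∈ iSup (tensDeg M N)) (fun i m hm => ?_) (by simp)
    (fun x y hx hy => by simpa using add_mem hx hy)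
  refine isInternal_induction N.isInternal n
    (C := fun n => tmul M N m n ∈ iSup (tensDeg M N)) (fun j n hn => ?_) (by simp)
    (fun x y hx hy => by simpa using add_mem hx hy)
  exact Submodule.mem_iSup_of_mem (i + j) (tensDeg_tmul M N hm hn)

theorem tensDeg_isInternal (M : GrBimod A B) (N : GrBimod B C) :
    DirectSum.IsInternal (tensDeg M N) := by
  obtain ⟨q, hq, hq1, hq2⟩ := exists_proj N.isInternal
  have hqb : ∀ (d e : ℤ), ∀ b ∈ B.deg e, ∀ n : N.carrier,
      q d (N.left b n) = N.left b (q (d - e) n) := by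
    intro d e b hb n
    refine isInternal_induction N.isInternal n
      (C := fun n => q d (N.left b n) = N.left b (q (d - e) n)) ?_ (by simp)
      (fun x y hx hy => by simp [hx, hy])
    intro j n hn
    have := N.left_mem hb hn
    by_cases h : e + j = d
    · subst h
      rw [hq1 _ _ this, add_sub_cancel_left, hq1 _ _ hn]
    · rw [hq2 _ _ h _ this, hq2 (d - e) j (by omega) n hn, map_zero]
  have H : ∀ d : ℤ, ∃ f : M.carrier →ₗ[k] (N.carrier →ₗ[k] M.R ⊗[B.carrier] N.L),
      ∀ (i : ℤ) (x : M.carrier) (hx : x ∈ M.deg i),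
        f x = (((tmul M N).compl₂ (q (d - i))).comp (M.deg i).subtype) ⟨x, hx⟩ :=
    fun d => exists_linearMap M.isInternal
      fun i => ((tmul M N).compl₂ (q (d - i))).comp (M.deg i).subtype
  choose f hf using H
  have hf' : ∀ (d i : ℤ), ∀ m ∈ M.deg i, ∀ n, f d m n = tmul M N m (q (d - i) n) := by
    intro d i m hm n; rw [hf d i m hm]; rfl
  have hbal : ∀ d (b : B.carrier) (m : M.carrier) (n : N.carrier),
      f d (M.right b m) n = f d m (N.left b n) := by
    intro d b m n
    refine isInternal_induction B.isInternal b
      (C := fun b => f d (M.right b m) n = f d m (N.left b n)) ?_ (by simp)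
      (fun x y hx hy => by simp [hx, hy])
    intro e b hb
    refine isInternal_induction M.isInternal m
      (C := fun m => f d (M.right b m) n = f d m (N.left b n)) ?_ (by simp)
      (fun x y hx hy => by simp [hx, hy])
    intro i m hm
    rw [hf' d _ _ (M.right_mem hb hm), hf' d i m hm, hqb _ _ b hb, tmul_balanced, sub_sub]
  have Hg : ∀ d : ℤ, ∃ g : M.R ⊗[B.carrier] N.L →+ M.R ⊗[B.carrier] N.L,
      ∀ m n, g (tmul M N m n) = f d m n := fun d =>
    ⟨TensorProduct.liftAddHom
      ((LinearMap.toAddMonoidHom'.comp (f d).toAddMonoidHom : M.carrier →+ N.carrier →+ _))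
      (fun b m n => hbal d b m n), fun m n => rfl⟩
  choose g hg using Hg
  have hgs : ∀ d (c : k) (t : M.R ⊗[B.carrier] N.L), g d (c • t) = c • g d t := by
    intro d c t
    refine tens_induction M N (P := fun t => g d (c • t) = c • g d t) t (by simp)
      (fun x y hx hy => by simp only [smul_add, map_add, hx, hy]) fun m n => ?_
    rw [← LinearMap.smul_apply, ← map_smul, hg, hg, map_smul, LinearMap.smul_apply]
  let p : ∀ _ : ℤ, M.R ⊗[B.carrier] N.L →ₗ[k] M.R ⊗[B.carrier] N.L := fun d =>
    { toFun := g d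
      map_add' := map_add (g d)
      map_smul' := hgs d }
  have hp : ∀ d m n, p d (tmul M N m n) = f d m n := hg
  refine isInternal_of_proj (iSup_tensDeg M N) p LinearMap.id Function.injective_id ?_ ?_
  · intro d t ht
    have : tensDeg M N d ≤ LinearMap.eqLocus (p d) LinearMap.id := by
      refine Submodule.span_le.2 ?_
      rintro _ ⟨i, j, m, n, hm, hn, hd, rfl⟩
      have := hp d m n
      rw [hf' d i m hm, show d - i = j by omega, hq1 j n hn] at this
      exact this
    exact this ht
  · intro d e hne t ht
    have : tensDeg M N e ≤ LinearMap.ker (p d) := by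
      refine Submodule.span_le.2 ?_
      rintro _ ⟨i, j, m, n, hm, hn, hd, rfl⟩
      have := hp d m n
      rw [hf' d i m hm, hq2 (d - i) j (by omega) n hn, map_zero] at this
      exact this
    exact this ht

theorem rTensor_leftR_tmul (M : GrBimod A B) (N : GrBimod B C) (a : A.carrier) (m : M.carrier)
    (n : N.carrier) :
    (M.leftR a).rTensor N.L (tmul M N m n) = tmul M N (M.left a m) n := rfl

theorem lTensor_rightL_tmul (M : GrBimod A B) (N : GrBimod B C) (c : C.carrier) (m : M.carrier)
    (n : N.carrier) :
    (N.rightL c).lTensor M.R (tmul M N m n) = tmul M N m (N.right c n) := rfl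

/-- The tensor product `M ⊗_B N` of graded bimodules, with `a (m ⊗ n) c = (a m) ⊗ (n c)`. -/
def tens (M : GrBimod A B) (N : GrBimod B C) : GrBimod A C where
  carrier := M.R ⊗[B.carrier] N.L
  left := AlgHom.ofLinearMap
    { toFun := fun a => ((M.leftR a).rTensor N.L).restrictScalars k
      map_add' := fun a a' => by rw [map_add, LinearMap.rTensor_add]; rfl
      map_smul' := fun c a => LinearMap.ext fun t => by
        refine tens_induction M N (P := fun t => ((M.leftR (c • a)).rTensor N.L) t = c • ((M.leftR a).rTensor N.L) t) t
          (by simp) (fun x y hx hy => by simp only [map_add, smul_add, hx, hy]) fun m n => ?_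
        rw [rTensor_leftR_tmul, rTensor_leftR_tmul, map_smul, LinearMap.smul_apply, map_smul,
          LinearMap.smul_apply] }
    (by
      change ((M.leftR 1).rTensor N.L).restrictScalars k = _
      rw [map_one, Module.End.one_eq_id, LinearMap.rTensor_id]; rfl)
    (fun a a' => by
      change ((M.leftR (a * a')).rTensor N.L).restrictScalars k = _
      rw [map_mul, Module.End.mul_eq_comp, LinearMap.rTensor_comp]; rfl)
  right := AlgHom.ofLinearMap
    { toFun := fun c => ((N.rightL c).lTensor M.R).restrictScalars k
      map_add' := fun a a' => by rw [map_add, LinearMap.lTensor_add]; rfl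
      map_smul' := fun c a => LinearMap.ext fun t => by
        refine tens_induction M N (P := fun t => ((N.rightL (c • a)).lTensor M.R) t = c • ((N.rightL a).lTensor M.R) t) t
          (by simp) (fun x y hx hy => by simp only [map_add, smul_add, hx, hy]) fun m n => ?_
        rw [lTensor_rightL_tmul, lTensor_rightL_tmul, map_smul, LinearMap.smul_apply, map_smul] }
    (by
      change ((N.rightL 1).lTensor M.R).restrictScalars k = _
      rw [map_one, Module.End.one_eq_id, LinearMap.lTensor_id]; rfl)
    (fun a a' => by
      change ((N.rightL (a * a')).lTensor M.R).restrictScalars k = _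
      rw [map_mul, Module.End.mul_eq_comp, LinearMap.lTensor_comp]; rfl)
  comm a b t := by
    change (M.leftR a).rTensor N.L ((N.rightL b).lTensor M.R t) =
      (N.rightL b).lTensor M.R ((M.leftR a).rTensor N.L t)
    rw [← LinearMap.comp_apply, ← LinearMap.comp_apply, LinearMap.rTensor_comp_lTensor,
      LinearMap.lTensor_comp_rTensor]
  deg := tensDeg M N
  isInternal := tensDeg_isInternal M N
  left_mem {e d a t} ha ht := by
    have : tensDeg M N d ≤ (tensDeg M N (e + d)).comap
        (((M.leftR a).rTensor N.L).restrictScalars k) := by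
      refine Submodule.span_le.2 ?_
      rintro _ ⟨i, j, m, n, hm, hn, hd, rfl⟩
      have := tensDeg_tmul M N (M.left_mem ha hm) hn
      rwa [add_assoc, hd] at this
    exact this ht
  right_mem {e d a t} ha ht := by
    have : tensDeg M N d ≤ (tensDeg M N (d + e)).comap
        (((N.rightL a).lTensor M.R).restrictScalars k) := by
      refine Submodule.span_le.2 ?_
      rintro _ ⟨i, j, m, n, hm, hn, hd, rfl⟩
      have := tensDeg_tmul M N hm (N.right_mem ha hn)
      rwa [← add_assoc, hd] at this
    exact this ht

end GrBimod

/-! ### Regular functions -/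

section Regular

variable (k : Type u) [Field k] {V : Type u} [AddCommGroup V] [Module k V]

/-- The algebra `𝒪(X)` of regular functions on a subset `X` of the `k`-vector space `V`: the
restrictions to `X` of the polynomial functions on `V`, i.e. the algebra of functions on `X`
generated by the restrictions of linear forms. -/
def regSubalg (X : Set V) : Subalgebra k (X → k) :=
  Algebra.adjoin k (Set.range fun (φ : Module.Dual k V) (x : X) => φ x)

/-- The `k`-algebra `𝒪(X)` of regular functions on `X`. -/
def Reg (X : Set V) : Type u := regSubalg k X

instance (X : Set V) : CommRing (Reg k X) := inferInstanceAs (CommRing (regSubalg k X))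

instance (X : Set V) : Algebra k (Reg k X) := inferInstanceAs (Algebra k (regSubalg k X))

instance (X : Set V) : FunLike (Reg k X) X k where
  coe f := Subtype.val (p := fun f => f ∈ regSubalg k X) f
  coe_injective := Subtype.val_injective

variable {k} in
@[ext] theorem Reg.ext {X : Set V} {f g : Reg k X} (h : ∀ x, f x = g x) : f = g :=
  DFunLike.ext f g h

variable {k} in
/-- Evaluation at a point. -/
def Reg.eval {X : Set V} (x : X) : Reg k X →ₐ[k] k :=
  (Pi.evalAlgHom k (fun _ : X => k) x).comp (regSubalg k X).val

@[simp] theorem Reg.zero_apply {X : Set V} (x : X) : (0 : Reg k X) x = 0 := rfl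

@[simp] theorem Reg.one_apply {X : Set V} (x : X) : (1 : Reg k X) x = 1 := rfl

variable {k}

@[simp] theorem Reg.eval_apply {X : Set V} (f : Reg k X) (x : X) : Reg.eval x f = f x := rfl

@[simp] theorem Reg.add_apply {X : Set V} (f g : Reg k X) (x : X) : (f + g) x = f x + g x := rfl

@[simp] theorem Reg.mul_apply {X : Set V} (f g : Reg k X) (x : X) : (f * g) x = f x * g x := rfl

@[simp] theorem Reg.algebraMap_apply {X : Set V} (c : k) (x : X) :
    algebraMap k (Reg k X) c x = c := rfl

variable (k)

/-- The restriction of linear forms to `X`. -/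
def linForm (X : Set V) : Module.Dual k V →ₗ[k] Reg k X where
  toFun φ := ⟨fun x => φ x, Algebra.subset_adjoin ⟨φ, rfl⟩⟩
  map_add' _ _ := rfl
  map_smul' _ _ := rfl

/-- The grading of `𝒪(X)`, with linear forms in degree `2`: the part of degree `2m` is spanned by
the products of `m` linear forms, and all the other parts vanish. -/
def regDeg (X : Set V) (d : ℤ) : Submodule k (Reg k X) :=
  ⨆ (m : ℕ) (_ : 2 * (m : ℤ) = d), LinearMap.range (linForm k X) ^ m

variable {k}

theorem mem_regDeg {X : Set V} {m : ℕ} {f : Reg k X}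
    (hf : f ∈ LinearMap.range (linForm k X) ^ m) : f ∈ regDeg k X (2 * m) :=
  Submodule.mem_iSup_of_mem m (Submodule.mem_iSup_of_mem rfl hf)

theorem regDeg_two_mul (X : Set V) (m : ℕ) :
    regDeg k X (2 * m) = LinearMap.range (linForm k X) ^ m := by
  refine le_antisymm (iSup₂_le fun m' h => ?_) fun f hf => mem_regDeg hf
  rw [show m' = m by omega]

theorem regDeg_induction {X : Set V} {C : ℤ → Reg k X → Prop} {d : ℤ} {f : Reg k X}
    (hf : f ∈ regDeg k X d) (h0 : ∀ d, C d 0) (hadd : ∀ d f g, C d f → C d g → C d (f + g))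
    (h : ∀ (m : ℕ), ∀ f ∈ LinearMap.range (linForm k X) ^ m, C (2 * m) f) : C d f := by
  refine Submodule.iSup_induction _ (motive := C d) hf (fun m f hf => ?_) (h0 d) (hadd d)
  refine Submodule.iSup_induction _ (motive := C d) hf (fun hm f hf => ?_) (h0 d) (hadd d)
  exact hm ▸ h m f hf

instance (X : Set V) : SetLike.GradedMonoid (regDeg k X) where
  one_mem := by
    have : (1 : Reg k X) ∈ LinearMap.range (linForm k X) ^ 0 := by
      rw [pow_zero]; exact Submodule.one_le.1 le_rfl
    simpa using mem_regDeg this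
  mul_mem i j f g hf hg := by
    refine regDeg_induction (C := fun i f => f * g ∈ regDeg k X (i + j)) hf (by simp)
      (fun d f f' h h' => by rw [add_mul]; exact add_mem h h') fun m f hf => ?_
    refine regDeg_induction (C := fun j g => f * g ∈ regDeg k X (2 * m + j)) hg (by simp)
      (fun d f f' h h' => by rw [mul_add]; exact add_mem h h') fun m' g hg => ?_
    have : f * g ∈ LinearMap.range (linForm k X) ^ (m + m') := by
      rw [pow_add]; exact Submodule.mul_mem_mul hf hg
    have := mem_regDeg this
    rwa [Nat.cast_add, mul_add] at this

theorem iSup_regDeg (X : Set V) : iSup (regDeg k X) = ⊤ := by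
  have hmul : ∀ f ∈ iSup (regDeg k X), ∀ g ∈ iSup (regDeg k X), f * g ∈ iSup (regDeg k X) := by
    intro f hf g hg
    refine Submodule.iSup_induction _ (motive := fun f => f * g ∈ iSup (regDeg k X)) hf
      (fun i f hf => ?_) (by simp) (fun f f' h h' => by rw [add_mul]; exact add_mem h h')
    refine Submodule.iSup_induction _ (motive := fun g => f * g ∈ iSup (regDeg k X)) hg
      (fun j g hg => ?_) (by simp) (fun f f' h h' => by rw [mul_add]; exact add_mem h h')
    exact Submodule.mem_iSup_of_mem (i + j) (SetLike.mul_mem_graded hf hg)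
  have hone : (1 : Reg k X) ∈ iSup (regDeg k X) :=
    Submodule.mem_iSup_of_mem 0 (SetLike.one_mem_graded (regDeg k X))
  rw [eq_top_iff]
  rintro ⟨f, hf⟩ -
  refine Algebra.adjoin_induction (p := fun f hf => (show Reg k X from ⟨f, hf⟩) ∈ iSup (regDeg k X))
    ?_ ?_ ?_ ?_ hf
  · rintro _ ⟨φ, rfl⟩
    refine Submodule.mem_iSup_of_mem (2 * (1 : ℕ)) (mem_regDeg ?_)
    rw [pow_one]; exact ⟨φ, rfl⟩
  · intro r
    have : (r • (1 : Reg k X)) ∈ iSup (regDeg k X) := Submodule.smul_mem _ r hone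
    rw [← Algebra.algebraMap_eq_smul_one] at this
    exact this
  · exact fun f g _ _ h h' => add_mem h h'
  · exact fun f g _ _ h h' => hmul _ h _ h'

theorem regDeg_smul {X : Set V} {m : ℕ} {f : Reg k X}
    (hf : f ∈ LinearMap.range (linForm k X) ^ m) (c : k) (x y : X) (h : (y : V) = c • (x : V)) :
    f y = c ^ m * f x := by
  induction hf using Submodule.pow_induction_on_left' with
  | algebraMap r => simp
  | add f g i _ _ hf hg =>
    change f y + g y = c ^ i * (f x + g x)
    rw [hf, hg, mul_add]
  | mem_mul l hl i f _ hf =>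
    obtain ⟨φ, rfl⟩ := hl
    change φ (y : V) * f y = c ^ (i + 1) * (φ (x : V) * f x)
    rw [hf, h, map_smul, smul_eq_mul]; ring

/-- A cone: a set stable under all homotheties. -/
def IsCone (X : Set V) : Prop := ∀ (c : k), ∀ x ∈ X, c • x ∈ X

theorem regDeg_isInternal [Infinite k] {X : Set V} (hX : IsCone (k := k) X) :
    DirectSum.IsInternal (regDeg k X) := by
  rw [DirectSum.isInternal_submodule_iff_iSupIndep_and_iSup_eq_top]
  refine ⟨fun d => ?_, iSup_regDeg X⟩
  rw [Submodule.disjoint_def]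
  intro f hf hf'
  have H : ∀ g ∈ (⨆ e, ⨆ (_ : e ≠ d), regDeg k X e), ∀ m : ℕ, 2 * (m : ℤ) = d → ∀ x : X,
      ∃ P : Polynomial k, P.coeff m = 0 ∧
        ∀ c : k, g ⟨c • (x : V), hX c x x.2⟩ = P.eval c := by
    intro g hg m hm x
    have h0 : ∃ P : Polynomial k, P.coeff m = 0 ∧
        ∀ c : k, (0 : Reg k X) ⟨c • (x : V), hX c x x.2⟩ = P.eval c :=
      ⟨0, by simp, fun c => by simp⟩
    have hadd : ∀ g g' : Reg k X,
        (∃ P : Polynomial k, P.coeff m = 0 ∧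
          ∀ c : k, g ⟨c • (x : V), hX c x x.2⟩ = P.eval c) →
        (∃ P : Polynomial k, P.coeff m = 0 ∧
          ∀ c : k, g' ⟨c • (x : V), hX c x x.2⟩ = P.eval c) →
        ∃ P : Polynomial k, P.coeff m = 0 ∧
          ∀ c : k, (g + g') ⟨c • (x : V), hX c x x.2⟩ = P.eval c := by
      rintro g g' ⟨P, hP, hP'⟩ ⟨Q, hQ, hQ'⟩
      refine ⟨P + Q, by simp [hP, hQ], fun c => ?_⟩
      rw [Polynomial.eval_add, ← hP', ← hQ']; rfl
    refine Submodule.iSup_induction _ (motive := fun g : Reg k X => ∃ P : Polynomial k,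
      P.coeff m = 0 ∧ ∀ c : k, g ⟨c • (x : V), hX c x x.2⟩ = P.eval c) hg
      (fun e g hg => ?_) h0 hadd
    refine Submodule.iSup_induction _ (motive := fun g : Reg k X => ∃ P : Polynomial k,
      P.coeff m = 0 ∧ ∀ c : k, g ⟨c • (x : V), hX c x x.2⟩ = P.eval c) hg
      (fun hne g hg => ?_) h0 hadd
    refine Submodule.iSup_induction _ (motive := fun g : Reg k X => ∃ P : Polynomial k,
      P.coeff m = 0 ∧ ∀ c : k, g ⟨c • (x : V), hX c x x.2⟩ = P.eval c) hg
      (fun m' g hg => ?_) h0 hadd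
    refine Submodule.iSup_induction _ (motive := fun g : Reg k X => ∃ P : Polynomial k,
      P.coeff m = 0 ∧ ∀ c : k, g ⟨c • (x : V), hX c x x.2⟩ = P.eval c) hg
      (fun hm' g hg => ?_) h0 hadd
    refine ⟨Polynomial.C (g x) * Polynomial.X ^ m', ?_, fun c => ?_⟩
    · rw [Polynomial.coeff_C_mul, Polynomial.coeff_X_pow, if_neg (by omega), mul_zero]
    · rw [regDeg_smul hg c x ⟨c • (x : V), hX c x x.2⟩ rfl]
      rw [Polynomial.eval_mul, Polynomial.eval_C, Polynomial.eval_pow, Polynomial.eval_X, mul_comm]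
  by_cases h : ∃ m : ℕ, 2 * (m : ℤ) = d
  · obtain ⟨m, hm⟩ := h
    rw [← hm, regDeg_two_mul] at hf
    ext x
    obtain ⟨P, hP, hP'⟩ := H f hf' m hm x
    have : P = Polynomial.C (f x) * Polynomial.X ^ m := by
      refine Polynomial.funext fun c => ?_
      rw [← hP', regDeg_smul hf c x ⟨c • (x : V), hX c x x.2⟩ rfl]
      rw [Polynomial.eval_mul, Polynomial.eval_C, Polynomial.eval_pow, Polynomial.eval_X, mul_comm]
    rw [this] at hP
    simpa using hP
  · have : regDeg k X d = ⊥ := by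
      rw [regDeg, eq_bot_iff]
      exact iSup₂_le fun m hm => (h ⟨m, hm⟩).elim
    rw [this] at hf
    exact hf

/-- The graded algebra of regular functions on a cone. -/
def regAlg [Infinite k] (X : Set V) (hX : IsCone (k := k) X) : GrAlg k where
  carrier := Reg k X
  deg := regDeg k X
  isInternal := regDeg_isInternal hX

/-- The pullback `𝒪(X) → 𝒪(Y)`, `f ↦ f ∘ g`, along a linear map `g` with `g(Y) ⊆ X`. -/
def pull {X Y : Set V} (g : V →ₗ[k] V) (h : Set.MapsTo g Y X) : Reg k X →ₐ[k] Reg k Y where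
  toFun f := ⟨fun y => f ⟨g y, h y.2⟩, by
    refine Algebra.adjoin_induction
      (p := fun f _ => (fun y : Y => f ⟨g y, h y.2⟩) ∈ regSubalg k Y) ?_ ?_ ?_ ?_ f.2
    · rintro _ ⟨φ, rfl⟩
      exact Algebra.subset_adjoin ⟨φ.comp g, rfl⟩
    · exact fun r => (regSubalg k Y).algebraMap_mem r
    · exact fun _ _ _ _ h h' => add_mem h h'
    · exact fun _ _ _ _ h h' => mul_mem h h'⟩
  map_one' := rfl
  map_mul' _ _ := rfl
  map_zero' := rfl
  map_add' _ _ := rfl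
  commutes' _ := rfl

/-- The restriction `𝒪(X) → 𝒪(Y)` for `Y ⊆ X`. -/
def res {X Y : Set V} (h : Y ⊆ X) : Reg k X →ₐ[k] Reg k Y := pull LinearMap.id h

theorem pull_mem {X Y : Set V} (g : V →ₗ[k] V) (h : Set.MapsTo g Y X) (d : ℤ) (f : Reg k X)
    (hf : f ∈ regDeg k X d) : pull g h f ∈ regDeg k Y d := by
  refine regDeg_induction (C := fun d f => pull g h f ∈ regDeg k Y d) hf (by simp)
    (fun d f f' h h' => by rw [map_add]; exact add_mem h h') fun m f hf => mem_regDeg ?_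
  have h1 : (LinearMap.range (linForm k X)).map (pull g h).toLinearMap ≤
      LinearMap.range (linForm k Y) := by
    rintro _ ⟨_, ⟨φ, rfl⟩, rfl⟩
    exact ⟨φ.comp g, rfl⟩
  have h2 := pow_le_pow_left' h1 m
  rw [← Submodule.map_pow] at h2
  exact h2 ⟨f, hf, rfl⟩

theorem res_mem {X Y : Set V} (h : Y ⊆ X) (d : ℤ) (f : Reg k X) (hf : f ∈ regDeg k X d) :
    res h f ∈ regDeg k Y d := pull_mem LinearMap.id _ d f hf

end Regular

namespace GrAlg

variable {k : Type u} [Field k]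

/-- The graded subalgebra of invariants of a degree preserving endomorphism. -/
def fixed (A : GrAlg k) (φ : A.carrier →ₐ[k] A.carrier)
    (hφ : ∀ d, ∀ a ∈ A.deg d, φ a ∈ A.deg d) : GrAlg k where
  carrier := AlgHom.equalizer φ (AlgHom.id k A.carrier)
  deg d := (A.deg d).comap (AlgHom.equalizer φ (AlgHom.id k A.carrier)).val.toLinearMap
  gradedMonoid :=
    { one_mem := SetLike.one_mem_graded A.deg
      mul_mem := fun _ _ _ _ ha hb => SetLike.mul_mem_graded (A := A.deg) ha hb }
  isInternal := by
    obtain ⟨p, hp, hp1, hp2⟩ := exists_proj A.isInternal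
    have hcomm : ∀ d a, φ (p d a) = p d (φ a) := by
      intro d a
      refine isInternal_induction A.isInternal a (C := fun a => φ (p d a) = p d (φ a)) ?_ (by simp)
        (fun x y hx hy => by simp [hx, hy])
      intro e x hx
      by_cases h : e = d
      · subst h; rw [hp1 _ _ hx, hp1 _ _ (hφ _ _ hx)]
      · rw [hp2 _ _ h _ hx, hp2 _ _ h _ (hφ _ _ hx), map_zero]
    refine isInternal_of_proj ?_
      (fun d => (p d).comp (AlgHom.equalizer φ (AlgHom.id k A.carrier)).val.toLinearMap)
      (AlgHom.equalizer φ (AlgHom.id k A.carrier)).val.toLinearMap Subtype.val_injective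
      (fun d m hm => hp1 d _ hm) (fun d e h m hm => hp2 d e h _ hm)
    rw [eq_top_iff]
    rintro ⟨a, ha⟩ -
    obtain ⟨s, hs⟩ := exists_sum_proj A.isInternal hp1 hp2 a
    have hfix : ∀ d, p d a ∈ AlgHom.equalizer φ (AlgHom.id k A.carrier) := fun d => by
      have h : φ a = a := ha
      change φ (p d a) = p d a
      rw [hcomm, h]
    have : (⟨a, ha⟩ : AlgHom.equalizer φ (AlgHom.id k A.carrier)) =
        ∑ d ∈ s, ⟨p d a, hfix d⟩ := by
      apply Subtype.ext
      rw [AddSubmonoidClass.coe_finsetSum]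
      exact hs.symm
    rw [this]
    exact sum_mem fun d _ => Submodule.mem_iSup_of_mem d (hp d a)

end GrAlg

/-! ### The product of bimodules -/

section Star

variable {k : Type u} [Field k]

/-- The annihilator of a graded module is a homogeneous ideal. -/
theorem proj_annihilates {A M : Type*} [CommRing A] [Algebra k A] [AddCommGroup M] [Module k M]
    {DA : ℤ → Submodule k A} (hA : DirectSum.IsInternal DA)
    (ρ : A →ₐ[k] Module.End k M) {D : ℤ → Submodule k M} (hD : DirectSum.IsInternal D)
    (hρ : ∀ i j : ℤ, ∀ a ∈ DA i, ∀ m ∈ D j, ρ a m ∈ D (i + j))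
    {p : ℤ → A →ₗ[k] A} (hp1 : ∀ d, ∀ m ∈ DA d, p d m = m)
    (hp2 : ∀ d e, e ≠ d → ∀ m ∈ DA e, p d m = 0)
    {a : A} (ha : ρ a = 0) (d : ℤ) : ρ (p d a) = 0 := by
  obtain ⟨q, -, hq1, hq2⟩ := exists_proj hD
  ext m
  refine isInternal_induction hD m (C := fun m => ρ (p d a) m = (0 : Module.End k M) m)
    (fun j m hm => ?_) (by simp) (fun x y hx hy => by simp [hx, hy])
  have key : ∀ a, ρ (p d a) m = q (d + j) (ρ a m) := by
    intro a
    refine isInternal_induction hA a (C := fun a => ρ (p d a) m = q (d + j) (ρ a m))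
      (fun e x hx => ?_) (by simp) (fun x y hx hy => by simp [hx, hy])
    by_cases h : e = d
    · subst h; rw [hp1 _ _ hx, hq1 _ _ (hρ _ _ _ hx _ hm)]
    · rw [hp2 _ _ h _ hx, hq2 _ (e + j) (by omega) _ (hρ _ _ _ hx _ hm)]; simp
  rw [key, ha]; simp

theorem eq_zero_of_annihilates {A M : Type*} [CommRing A] [Algebra k A] [AddCommGroup M]
    [Module k M] {DA : ℤ → Submodule k A} (hA : DirectSum.IsInternal DA)
    (ρ : A →ₐ[k] Module.End k M) {D : ℤ → Submodule k M} (hD : DirectSum.IsInternal D)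
    (hρ : ∀ i j : ℤ, ∀ a ∈ DA i, ∀ m ∈ D j, ρ a m ∈ D (i + j)) (ev : A →ₗ[k] k)
    (hev : ∀ d, ∀ a ∈ DA d, ρ a = 0 → ev a = 0) {a : A} (ha : ρ a = 0) : ev a = 0 := by
  obtain ⟨p, hp, hp1, hp2⟩ := exists_proj hA
  obtain ⟨s, hs⟩ := exists_sum_proj hA hp1 hp2 a
  rw [← hs, map_sum]
  exact Finset.sum_eq_zero fun d _ =>
    hev d _ (hp d a) (proj_annihilates hA ρ hD hρ hp1 hp2 ha d)

variable {V : Type u} [AddCommGroup V] [Module k V]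

theorem regDeg_homothety {X : Set V} (d : ℤ) :
    ∃ m : ℕ, ∀ f ∈ regDeg k X d, ∀ (c : k) (x y : X), (y : V) = c • (x : V) →
      f y = c ^ m * f x := by
  by_cases h : ∃ m : ℕ, 2 * (m : ℤ) = d
  · obtain ⟨m, rfl⟩ := h
    refine ⟨m, fun f hf c x y hxy => ?_⟩
    rw [regDeg_two_mul] at hf
    exact regDeg_smul hf c x y hxy
  · have : regDeg k X d = ⊥ := by
      rw [regDeg, eq_bot_iff]
      exact iSup₂_le fun m hm => (h ⟨m, hm⟩).elim
    refine ⟨0, fun f hf c x y _ => ?_⟩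
    rw [this] at hf
    rw [(Submodule.mem_bot k).1 hf]
    simp

variable [Infinite k] {Z : Set V} {hZ : IsCone (k := k) Z}

/-- The closed subset of `Z` defined by the annihilator of an action of `𝒪(Z)`. -/
def annVar (Z : Set V) {M : Type*} [AddCommGroup M] [Module k M]
    (ρ : Reg k Z →ₐ[k] Module.End k M) : Set V :=
  {v | ∃ h : v ∈ Z, ∀ f : Reg k Z, ρ f = 0 → f ⟨v, h⟩ = 0}

theorem annVar_isCone {M : Type*} [AddCommGroup M] [Module k M]
    (ρ : Reg k Z →ₐ[k] Module.End k M) {D : ℤ → Submodule k M} (hD : DirectSum.IsInternal D)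
    (hρ : ∀ i j : ℤ, ∀ a ∈ regDeg k Z i, ∀ m ∈ D j, ρ a m ∈ D (i + j))
    (hZ : IsCone (k := k) Z) : IsCone (k := k) (annVar Z ρ) := by
  rintro c v ⟨hv, h⟩
  refine ⟨hZ c v hv, fun f hf => ?_⟩
  refine eq_zero_of_annihilates (regDeg_isInternal hZ) ρ hD hρ
    (Reg.eval (⟨c • v, hZ c v hv⟩ : Z)).toLinearMap
    (fun d g hg h1 => ?_) hf
  obtain ⟨m, hm⟩ := regDeg_homothety (k := k) (X := Z) d
  have h2 := hm g hg c ⟨v, hv⟩ ⟨c • v, hZ c v hv⟩ rfl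
  rw [h g h1, mul_zero] at h2
  exact h2

namespace GrBimod

variable {A : GrAlg k}

/-- The variety `V_M^r ⊆ Z` of the right annihilator of `M`. -/
def rightVar (M : GrBimod A (regAlg Z hZ)) : Set V := annVar Z M.right

/-- The variety `V_M^ℓ ⊆ Z` of the left annihilator of `M`. -/
def leftVar (M : GrBimod (regAlg Z hZ) A) : Set V := annVar Z M.left

theorem rightVar_isCone (M : GrBimod A (regAlg Z hZ)) : IsCone (k := k) M.rightVar :=
  annVar_isCone M.right M.isInternal
    (fun _ _ _ ha _ hm => by rw [add_comm]; exact M.right_mem ha hm) hZ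

theorem leftVar_isCone (M : GrBimod (regAlg Z hZ) A) : IsCone (k := k) M.leftVar :=
  annVar_isCone M.left M.isInternal (fun _ _ _ ha _ hm => M.left_mem ha hm) hZ

variable (hZ) in
/-- The algebra `𝒪(X)`, for `X ⊆ Z`, as a graded `(𝒪(Z), 𝒪(Z))`-bimodule. -/
def regBimod (X : Set V) (hX : IsCone (k := k) X) (h : X ⊆ Z) :
    GrBimod (regAlg Z hZ) (regAlg Z hZ) :=
  ofAlgHom (regAlg X hX) (res h) (res_mem h) (res h) (res_mem h)

/-- The product `M ∗ N = M ⊗_{𝒪(Z)} 𝒪(V_M^r ∩ V_N^ℓ) ⊗_{𝒪(Z)} N`. -/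
def star (M N : GrBimod (regAlg Z hZ) (regAlg Z hZ)) : GrBimod (regAlg Z hZ) (regAlg Z hZ) :=
  (M.tens (regBimod hZ (M.rightVar ∩ N.leftVar)
    (fun c v hv => ⟨M.rightVar_isCone c v hv.1, N.leftVar_isCone c v hv.2⟩)
    (fun _ hv => hv.1.1))).tens N

end GrBimod

end Star

/-! ### Weyl lines in type `A` -/

section WeylLines

variable (k : Type u) [Field k] (n : ℕ)

/-- The geometric representation of the symmetric group on `n + 1` letters: the hyperplane
`∑ i, v i = 0` in `k ^ (n + 1)`. -/
abbrev Geom : Submodule k (Fin (n + 1) → k) :=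
  LinearMap.ker (∑ i, LinearMap.proj i : (Fin (n + 1) → k) →ₗ[k] k)

variable {n}

/-- The action of a permutation `w` on the geometric representation, `(w v) i = v (w⁻¹ i)`. -/
def act (w : Equiv.Perm (Fin (n + 1))) : Geom k n →ₗ[k] Geom k n :=
  (LinearMap.funLeft k k (w⁻¹ : Equiv.Perm (Fin (n + 1)))).restrict fun v hv => by
    simp only [LinearMap.mem_ker, LinearMap.sum_apply, LinearMap.proj_apply,
      LinearMap.funLeft_apply] at hv ⊢
    rw [← hv]
    exact Equiv.sum_comp (w⁻¹) v

/-- The subspace `H_w` of points fixed by `w`: the reflecting hyperplane if `w` is a reflection. -/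
def hyp (w : Equiv.Perm (Fin (n + 1))) : Submodule k (Geom k n) :=
  LinearMap.eqLocus (act k w) LinearMap.id

/-- A Weyl line: a subspace of dimension one which is an intersection of reflecting hyperplanes
(the reflections in the symmetric group being the transpositions). -/
def IsWeylLine (ℓ : Submodule k (Geom k n)) : Prop :=
  Module.finrank k ℓ = 1 ∧
    ∃ S : Set (Equiv.Perm (Fin (n + 1))), (∀ t ∈ S, t.IsSwap) ∧ ℓ = ⨅ t ∈ S, hyp k t

variable (n)

/-- The union `Z` of all Weyl lines. -/
def weylZ : Set (Geom k n) := {v | ∃ ℓ, IsWeylLine k ℓ ∧ v ∈ ℓ}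

variable {n}

/-- The union `V_t` of all Weyl lines transverse to the reflection `t`, i.e. not contained in
`H_t`. -/
def weylV (t : Equiv.Perm (Fin (n + 1))) : Set (Geom k n) :=
  {v | ∃ ℓ, IsWeylLine k ℓ ∧ ¬ ℓ ≤ hyp k t ∧ v ∈ ℓ}

theorem weylZ_isCone : IsCone (k := k) (weylZ k n) := by
  rintro c v ⟨ℓ, hℓ, hv⟩
  exact ⟨ℓ, hℓ, ℓ.smul_mem c hv⟩

theorem weylV_isCone (t : Equiv.Perm (Fin (n + 1))) : IsCone (k := k) (weylV k t) := by
  rintro c v ⟨ℓ, hℓ, ht, hv⟩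
  exact ⟨ℓ, hℓ, ht, ℓ.smul_mem c hv⟩

theorem weylV_subset (t : Equiv.Perm (Fin (n + 1))) : weylV k t ⊆ weylZ k n := by
  rintro v ⟨ℓ, hℓ, ht, hv⟩
  exact ⟨ℓ, hℓ, hv⟩

theorem act_mul (w w' : Equiv.Perm (Fin (n + 1))) (v : Geom k n) :
    act k (w * w') v = act k w (act k w' v) := by
  apply Subtype.ext
  funext i
  change v.1 ((w * w')⁻¹ i) = v.1 (w'⁻¹ (w⁻¹ i))
  rw [mul_inv_rev]; rfl

theorem act_one (v : Geom k n) : act k 1 v = v := rfl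

theorem mem_hyp_conj (w t : Equiv.Perm (Fin (n + 1))) (v : Geom k n) :
    v ∈ hyp k (w * t * w⁻¹) ↔ act k w⁻¹ v ∈ hyp k t := by
  change act k (w * t * w⁻¹) v = v ↔ act k t (act k w⁻¹ v) = act k w⁻¹ v
  constructor
  · intro h
    conv_rhs => rw [← h]
    rw [← act_mul, ← act_mul]
    simp [mul_assoc]
  · intro h
    rw [mul_assoc, act_mul, act_mul, h, ← act_mul, mul_inv_cancel, act_one]

/-- The action of a permutation as a linear automorphism. -/
def actEquiv (w : Equiv.Perm (Fin (n + 1))) : Geom k n ≃ₗ[k] Geom k n :=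
  LinearEquiv.ofLinearMap (act k w) (act k w⁻¹)
    (LinearMap.ext fun v => by
      rw [LinearMap.comp_apply, ← act_mul, mul_inv_cancel, act_one, LinearMap.id_apply])
    (LinearMap.ext fun v => by
      rw [LinearMap.comp_apply, ← act_mul, inv_mul_cancel, act_one, LinearMap.id_apply])

theorem isWeylLine_map {ℓ : Submodule k (Geom k n)} (hℓ : IsWeylLine k ℓ)
    (w : Equiv.Perm (Fin (n + 1))) : IsWeylLine k (ℓ.map (actEquiv k w).toLinearMap) := by
  obtain ⟨h1, S, hS, rfl⟩ := hℓ
  refine ⟨(LinearEquiv.finrank_map_eq (actEquiv k w) _).trans h1,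
    {t | w⁻¹ * t * w ∈ S}, fun t ht => ?_, ?_⟩
  · obtain ⟨x, y, hxy, h⟩ := hS _ ht
    refine ⟨w x, w y, fun h => hxy (w.injective h), ?_⟩
    rw [Equiv.swap_apply_apply, ← h]
    simp [mul_assoc]
  · ext v
    have hmem : v ∈ (⨅ t ∈ S, hyp k t).map (actEquiv k w).toLinearMap ↔
        act k w⁻¹ v ∈ ⨅ t ∈ S, hyp k t := by
      constructor
      · rintro ⟨x, hx, rfl⟩
        have : act k w⁻¹ (act k w x) = x := by rw [← act_mul, inv_mul_cancel, act_one]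
        change act k w⁻¹ (act k w x) ∈ _
        rwa [this]
      · intro h
        refine ⟨_, h, ?_⟩
        change act k w (act k w⁻¹ v) = v
        rw [← act_mul, mul_inv_cancel, act_one]
    rw [hmem]
    simp only [Submodule.mem_iInf, Set.mem_ofPred_eq]
    constructor
    · intro h t ht
      have := (mem_hyp_conj k w _ v).2 (h _ ht)
      simpa [mul_assoc] using this
    · intro h t ht
      exact (mem_hyp_conj k w t v).1 (h _ (by simpa [mul_assoc] using ht))

theorem mapsTo_weylV (t : Equiv.Perm (Fin (n + 1))) :
    Set.MapsTo (act k t) (weylV k t) (weylV k t) := by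
  rintro v ⟨ℓ, hℓ, ht, hv⟩
  refine ⟨_, isWeylLine_map k hℓ t, fun h => ht fun x hx => ?_, ⟨v, hv, rfl⟩⟩
  have h2 : act k t (act k t x) = act k t x := h ⟨x, hx, rfl⟩
  exact (actEquiv k t).injective h2

variable [CharZero k]

variable (n) in
/-- The graded algebra `R̄ = 𝒪(Z)` of regular functions on the union of the Weyl lines. -/
abbrev RBar : GrAlg k := regAlg (weylZ k n) (weylZ_isCone k)

/-- The graded algebra `𝒪(V_t)`. -/
abbrev RT (t : Equiv.Perm (Fin (n + 1))) : GrAlg k := regAlg (weylV k t) (weylV_isCone k t)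

/-- The graded subalgebra `𝒪(V_t)^t` of `t`-invariant functions. -/
abbrev RTInv (t : Equiv.Perm (Fin (n + 1))) : GrAlg k :=
  (RT k t).fixed (pull (act k t) (mapsTo_weylV k t)) (pull_mem _ (mapsTo_weylV k t))

/-- The inclusion `𝒪(V_t)^t → 𝒪(V_t)`. -/
def inclInv (t : Equiv.Perm (Fin (n + 1))) : (RTInv k t).carrier →ₐ[k] (RT k t).carrier :=
  (AlgHom.equalizer (pull (act k t) (mapsTo_weylV k t)) (AlgHom.id k _)).val

/-- The graded `(R̄, R̄)`-bimodule `𝒪(V_t) ⊗_{𝒪(V_t)^t} 𝒪(V_t)`. -/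
def bimodT (t : Equiv.Perm (Fin (n + 1))) : GrBimod (RBar k n) (RBar k n) :=
  GrBimod.tens (B := RTInv k t)
    (GrBimod.ofAlgHom (RT k t) (res (weylV_subset k t)) (res_mem (weylV_subset k t))
      (inclInv k t) (fun _ _ h => h))
    (GrBimod.ofAlgHom (RT k t) (inclInv k t) (fun _ _ h => h)
      (res (weylV_subset k t)) (res_mem (weylV_subset k t)))

/-- The bimodule `B_i = R_i ⊗_{R_i^{s_i}} R_i` attached to the simple reflection
`s_i = (i, i + 1)`. -/
def bimodB (i : Fin n) : GrBimod (RBar k n) (RBar k n) :=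
  bimodT k (Equiv.swap i.castSucc i.succ)

end WeylLines

end TLBimod

end

noncomputable section

namespace TLBimod

open scoped TensorProduct

universe u

namespace GrBimod

/-! ### Maps out of cyclic graded bimodules -/

section Bimodules

variable {k : Type u} [Field k] {A B C : GrAlg k}

/-! Every bimodule here is described by functions on a correspondence, that is, on a set `T` with
two maps `l`, `r` to `Z` (`IsModel`). The bimodule `B_s` is generated by `1 ⊗ 1` and embeds into the
functions on the pairs `(x, x)` and `(x, s x)`, where `x` runs over the points of `Z` moved by `s`
(`exists_isModel_bimodT`). When the generator of a cyclic bimodule is the constant function `1`, its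
annihilator in `R̄ ⊗ R̄` consists of the elements vanishing on the image of `T` in `Z × Z`. So two
such bimodules with the same image are isomorphic (`IsModel.isomorphic`), and the relations between
products with `s ≠ t` become equalities of subsets of `Z × Z`, once `M ∗ N` is known to be a cyclic
bimodule of functions.

It is a bimodule of functions on the fibre product of the two correspondences (`IsModel.star`).
Every function is `f₀ + α f₁` with `f₀`, `f₁` invariant under `s` and `α` the root of `s`
(`exists_inv_decomp`). Hence each factor has two generators over the middle ring, and these are
separated by evaluation because `α` differs at `x` and `s x`. What remains is a function on `V_M^r ∩
V_N^ℓ`, which is determined by its values at the points moved by both reflections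
(`ev_eq_zero_of_mem_mid`).

For cyclicity, functions must be moved out of the middle. If `s` and `t` commute, the root of `s` is
`t`-invariant, which allows this, and both products are supported on the graphs of `1`, `s`, `t`,
`st`. If `s = (a b)` and `t = (c b)`, a point of a Weyl line takes at most two values, so a point
moved by both has `x_a = x_c`. Consequently every function agrees on such points with an
`s`-invariant one (`exists_isInv_eq`), and `s` fixes `t x`. A path `x → y → y' → z` along `s`, `t`,
`s` then has `y' = y`, and its ends form a point of the support of `B_s` (`Supp.exists_comp₃`).

If `s = t`, then `1 ⊗ 1 ⊗ 1` and `1 ⊗ α ⊗ 1` each generate a copy of `B_s`, the second shifted by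
the degree `2` of `α`; the decomposition `f₀ + α f₁` of the middle function gives surjectivity, and
the separation of `x` from `s x` gives injectivity. -/

theorem Isomorphic.symm {M N : GrBimod A B} (h : M.Isomorphic N) : N.Isomorphic M := by
  obtain ⟨e, hl, hr, hd⟩ := h
  refine ⟨e.symm, fun a m => ?_, fun b m => ?_, fun d m => ?_⟩
  · rw [LinearEquiv.symm_apply_eq, hl, e.apply_symm_apply]
  · rw [LinearEquiv.symm_apply_eq, hr, e.apply_symm_apply]
  · rw [← hd, e.apply_symm_apply]

/-- A bijective bimodule map which preserves degrees is an isomorphism of graded bimodules. -/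
theorem isomorphic_of_bijective {M N : GrBimod A B} (e : M.carrier →ₗ[k] N.carrier)
    (he : Function.Bijective e) (hl : ∀ a m, e (M.left a m) = N.left a (e m))
    (hr : ∀ b m, e (M.right b m) = N.right b (e m))
    (hd : ∀ d, ∀ m ∈ M.deg d, e m ∈ N.deg d) : M.Isomorphic N := by
  refine ⟨LinearEquiv.ofBijective e he, hl, hr, fun d m => ⟨fun h => ?_, hd d m⟩⟩
  obtain ⟨p, hp, hp1, hp2⟩ := exists_proj M.isInternal
  obtain ⟨q, -, hq1, hq2⟩ := exists_proj N.isInternal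
  -- A map preserving degrees commutes with the projections to homogeneous parts; with injectivity
  -- this gives the converse implication on degrees.
  have key : q d (e m) = e (p d m) := by
    refine isInternal_induction M.isInternal m (C := fun m => q d (e m) = e (p d m))
      (fun j m hm => ?_) (by simp) (fun x y hx hy => by simp [hx, hy])
    by_cases h : j = d
    · subst h; rw [hp1 _ _ hm, hq1 _ _ (hd _ _ hm)]
    · rw [hp2 _ _ h _ hm, hq2 _ _ h _ (hd _ _ hm), map_zero]
  have h' : e m ∈ N.deg d := h
  rw [hq1 d _ h'] at key
  rw [he.1 key]
  exact hp d m

/-- A balanced bilinear map induces a linear map on the tensor product. -/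
theorem exists_tens_lift (M : GrBimod A B) (N : GrBimod B C) {W : Type*} [AddCommGroup W]
    [Module k W] (F : M.carrier →ₗ[k] N.carrier →ₗ[k] W)
    (hF : ∀ b m n, F (M.right b m) n = F m (N.left b n)) :
    ∃ G : (M.tens N).carrier →ₗ[k] W, ∀ m n, G (tmul M N m n) = F m n := by
  let g : M.R ⊗[B.carrier] N.L →+ W := TensorProduct.liftAddHom
      ((LinearMap.toAddMonoidHom'.comp F.toAddMonoidHom : M.carrier →+ N.carrier →+ _))
      (fun b m n => hF b m n)
  have hg : ∀ m n, g (tmul M N m n) = F m n := fun m n => rfl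
  refine ⟨{ g with map_smul' := fun c t => ?_ }, hg⟩
  change g (c • t) = c • g t
  refine tens_induction M N (P := fun t => g (c • t) = c • g t) t (by simp)
    (fun x y hx hy => by simp only [smul_add, map_add, hx, hy]) fun m n => ?_
  rw [← LinearMap.smul_apply, ← map_smul, hg, hg, map_smul, LinearMap.smul_apply]

theorem tens_right_tmul (M : GrBimod A B) (N : GrBimod B C) (c : C.carrier) (m : M.carrier)
    (n : N.carrier) : (M.tens N).right c (tmul M N m n) = tmul M N m (N.right c n) := rfl

/-- The map `A ⊗ B → M`, `a ⊗ b ↦ a m b`. -/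
def orb (M : GrBimod A B) (m : M.carrier) : A.carrier ⊗[k] B.carrier →ₗ[k] M.carrier :=
  TensorProduct.lift (LinearMap.mk₂ k (fun a b => M.left a (M.right b m))
    (fun a a' b => by rw [map_add, LinearMap.add_apply])
    (fun c a b => by rw [map_smul, LinearMap.smul_apply])
    (fun a b b' => by rw [map_add, LinearMap.add_apply, map_add])
    (fun c a b => by rw [map_smul, LinearMap.smul_apply, map_smul]))

@[simp] theorem orb_tmul (M : GrBimod A B) (m : M.carrier) (a : A.carrier) (b : B.carrier) :
    M.orb m (a ⊗ₜ b) = M.left a (M.right b m) := rfl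

theorem left_orb (M : GrBimod A B) (m : M.carrier) (a : A.carrier)
    (τ : A.carrier ⊗[k] B.carrier) :
    M.left a (M.orb m τ) = M.orb m ((LinearMap.mulLeft k a).rTensor B.carrier τ) := by
  induction τ with
  | zero => simp
  | add x y hx hy => simp only [map_add, hx, hy]
  | tmul x y => simp

theorem right_orb (M : GrBimod A B) (m : M.carrier) (b : B.carrier)
    (τ : A.carrier ⊗[k] B.carrier) :
    M.right b (M.orb m τ) = M.orb m ((LinearMap.mulLeft k b).lTensor A.carrier τ) := by
  induction τ with
  | zero => simp
  | add x y hx hy => simp only [map_add, hx, hy]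
  | tmul x y => simp [← M.comm]

/-- An element which generates `M` as a bimodule. -/
def IsGen (M : GrBimod A B) (m : M.carrier) : Prop := Function.Surjective (M.orb m)

@[elab_as_elim]
theorem isGen_induction {M : GrBimod A B} {m₀ : M.carrier} (h : M.IsGen m₀)
    {P : M.carrier → Prop} (m : M.carrier) (h0 : P 0) (hadd : ∀ x y, P x → P y → P (x + y))
    (hP : ∀ a b, P (M.left a (M.right b m₀))) : P m := by
  obtain ⟨τ, rfl⟩ := h m
  induction τ with
  | zero => simpa using h0
  | add x y hx hy => simpa using hadd _ _ hx hy
  | tmul a b => exact hP a b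

/-- A bimodule map out of a bimodule with a generator of degree `0`. -/
theorem exists_hom_of_isGen {M N : GrBimod A B} {m₀ : M.carrier} {n₀ : N.carrier} {s : ℤ}
    (hm : M.IsGen m₀) (hm₀ : m₀ ∈ M.deg 0) (hn₀ : n₀ ∈ N.deg s)
    (hker : ∀ τ, M.orb m₀ τ = 0 → N.orb n₀ τ = 0) :
    ∃ g : M.carrier →ₗ[k] N.carrier, (∀ τ, g (M.orb m₀ τ) = N.orb n₀ τ) ∧
      (∀ a m, g (M.left a m) = N.left a (g m)) ∧ (∀ b m, g (M.right b m) = N.right b (g m)) ∧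
      ∀ d, ∀ m ∈ M.deg d, g m ∈ N.deg (d + s) := by
  -- A `k`-linear section of the orbit map. The choice is immaterial by `hker`, and this
  -- independence makes the composite a bimodule map.
  obtain ⟨σ, hσ⟩ := (M.orb m₀).exists_rightInverse_of_surjective (LinearMap.range_eq_top.2 hm)
  have hσ' : ∀ m, M.orb m₀ (σ m) = m := fun m => LinearMap.congr_fun hσ m
  have hg : ∀ τ, (N.orb n₀ ∘ₗ σ) (M.orb m₀ τ) = N.orb n₀ τ := by
    intro τ
    rw [LinearMap.comp_apply, ← sub_eq_zero, ← map_sub]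
    exact hker _ (by rw [map_sub, hσ', sub_self])
  set g := N.orb n₀ ∘ₗ σ
  have hl : ∀ a m, g (M.left a m) = N.left a (g m) := by
    intro a m
    obtain ⟨τ, rfl⟩ := hm m
    rw [left_orb, hg, hg, left_orb]
  have hr : ∀ b m, g (M.right b m) = N.right b (g m) := by
    intro a m
    obtain ⟨τ, rfl⟩ := hm m
    rw [right_orb, hg, hg, right_orb]
  refine ⟨g, hg, hl, hr, fun d m hmd => ?_⟩
  obtain ⟨p, -, hp1, hp2⟩ := exists_proj M.isInternal
  obtain ⟨q, hq, hq1, hq2⟩ := exists_proj N.isInternal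
  -- The map raises degrees by `s` on `a m₀ b` with `a`, `b` homogeneous, and such elements span
  -- `M`.
  have key : ∀ m, q (d + s) (g m) = g (p d m) := by
    intro m
    refine isGen_induction hm m (by simp) (fun x y hx hy => by simp [hx, hy]) fun a b => ?_
    refine isInternal_induction A.isInternal a
      (C := fun a => q (d + s) (g (M.left a (M.right b m₀))) = g (p d (M.left a (M.right b m₀))))
      (fun i a ha => ?_) (by simp)
      (fun x y hx hy => by simp only [map_add, LinearMap.add_apply, hx, hy])
    refine isInternal_induction B.isInternal b
      (C := fun b => q (d + s) (g (M.left a (M.right b m₀))) = g (p d (M.left a (M.right b m₀))))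
      (fun j b hb => ?_) (by simp)
      (fun x y hx hy => by simp only [map_add, LinearMap.add_apply, hx, hy])
    have h1 := M.left_mem ha (M.right_mem hb hm₀)
    have h2 : g (M.left a (M.right b m₀)) ∈ N.deg (i + (0 + j) + s) := by
      have := N.left_mem ha (N.right_mem hb hn₀)
      rw [← orb_tmul, ← hg, orb_tmul] at this
      convert this using 2
      ring
    by_cases h : i + (0 + j) = d
    · subst h; rw [hp1 _ _ h1, hq1 _ _ h2]
    · rw [hp2 _ _ h _ h1, hq2 _ _ (fun h' => h (by linarith)) _ h2, map_zero]
  rw [← hp1 d m hmd, ← key]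
  exact hq _ _

end Bimodules

/-! ### Surjectivity of restriction -/

section Restriction

variable {k : Type u} [Field k] {V : Type u} [AddCommGroup V] [Module k V]

/-- Restriction of functions is surjective. -/
theorem res_surjective {X Y : Set V} (h : Y ⊆ X) : Function.Surjective (res (k := k) h) := by
  rintro ⟨f, hf⟩
  have : ∃ g : Reg k X, ∀ y (hy : y ∈ Y), g ⟨y, h hy⟩ = f ⟨y, hy⟩ := by
    refine Algebra.adjoin_induction
      (p := fun f _ => ∃ g : Reg k X, ∀ y (hy : y ∈ Y), g ⟨y, h hy⟩ = f ⟨y, hy⟩) ?_ ?_ ?_ ?_ hf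
    · rintro _ ⟨φ, rfl⟩
      exact ⟨linForm k X φ, fun y hy => rfl⟩
    · exact fun r => ⟨algebraMap k _ r, fun y hy => rfl⟩
    · rintro f g _ _ ⟨f', hf'⟩ ⟨g', hg'⟩
      exact ⟨f' + g', fun y hy => by rw [Reg.add_apply, hf', hg', Pi.add_apply]⟩
    · rintro f g _ _ ⟨f', hf'⟩ ⟨g', hg'⟩
      exact ⟨f' * g', fun y hy => by rw [Reg.mul_apply, hf', hg', Pi.mul_apply]⟩
  obtain ⟨g, hg⟩ := this
  exact ⟨g, Reg.ext fun y => hg y y.2⟩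

end Restriction

/-! ### Bimodules of functions on correspondences -/

section Models

variable {k : Type u} [Field k] {V : Type u} [AddCommGroup V] [Module k V] [Infinite k]
  {Z : Set V} {hZ : IsCone (k := k) Z}

/-- Evaluation of a function on a cone at a point. -/
def ev (x : Z) : (regAlg Z hZ).carrier →ₐ[k] k := Reg.eval x

theorem ev_ext {f g : (regAlg Z hZ).carrier} (h : ∀ x, ev x f = ev x g) : f = g :=
  Reg.ext h

/-- `φ` identifies `M` with an `(𝒪(Z), 𝒪(Z))`-bimodule of functions on `T`, on which the left and
right action are multiplication of functions pulled back along `l` and `r`; the element `m₀` of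
degree `0` corresponds to the constant function `1`. -/
structure IsModel (M : GrBimod (regAlg Z hZ) (regAlg Z hZ)) (m₀ : M.carrier) {T : Type*}
    (l r : T → Z) (φ : M.carrier →ₗ[k] T → k) : Prop where
  left : ∀ a m t, φ (M.left a m) t = ev (l t) a * φ m t
  right : ∀ b m t, φ (M.right b m) t = ev (r t) b * φ m t
  gen : ∀ t, φ m₀ t = 1
  inj : Function.Injective φ
  gen_mem : m₀ ∈ M.deg 0

/-- Evaluation of an element of `𝒪(Z) ⊗ 𝒪(Z)` at a point of `Z × Z`. -/
def evalPair (x y : Z) : (regAlg Z hZ).carrier ⊗[k] (regAlg Z hZ).carrier →ₗ[k] k :=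
  TensorProduct.lift ((LinearMap.mul k k).compl₁₂ (ev x).toLinearMap (ev y).toLinearMap)

variable {M N : GrBimod (regAlg Z hZ) (regAlg Z hZ)} {m₀ : M.carrier} {n₀ : N.carrier}
  {T T' : Type*} {l r : T → Z} {l' r' : T' → Z} {φ : M.carrier →ₗ[k] T → k}
  {φ' : N.carrier →ₗ[k] T' → k}

theorem IsModel.map_orb (h : IsModel M m₀ l r φ) (m : M.carrier) (t : T)
    (τ : (regAlg Z hZ).carrier ⊗[k] (regAlg Z hZ).carrier) :
    φ (M.orb m τ) t = evalPair (l t) (r t) τ * φ m t := by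
  induction τ with
  | zero => simp
  | add x y hx hy => simp only [map_add, Pi.add_apply, hx, hy, add_mul]
  | tmul a b => rw [orb_tmul, h.left, h.right, ← mul_assoc]; rfl

/-- The orbit of the generator is the function `τ (l t, r t)`. So the relations satisfied by `m₀`
depend only on the image of `T` in `Z × Z`, which is what makes the support a complete invariant of
cyclic models. -/
theorem IsModel.orb_eq_zero (h : IsModel M m₀ l r φ)
    (τ : (regAlg Z hZ).carrier ⊗[k] (regAlg Z hZ).carrier) :
    M.orb m₀ τ = 0 ↔ ∀ t, evalPair (l t) (r t) τ = 0 := by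
  constructor
  · intro h0 t
    have := h.map_orb m₀ t τ
    rw [h0, h.gen] at this
    simpa using this.symm
  · intro h0
    refine h.inj (funext fun t => ?_)
    rw [h.map_orb, h0, map_zero, zero_mul]; rfl

/-- Cyclic bimodules of functions with the same support are isomorphic. -/
theorem IsModel.isomorphic (h : IsModel M m₀ l r φ) (h' : IsModel N n₀ l' r' φ')
    (hg : M.IsGen m₀) (hg' : N.IsGen n₀) (h1 : ∀ t, ∃ t', l' t' = l t ∧ r' t' = r t)
    (h2 : ∀ t', ∃ t, l t = l' t' ∧ r t = r' t') : M.Isomorphic N := by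
  have hker : ∀ τ, M.orb m₀ τ = 0 ↔ N.orb n₀ τ = 0 := by
    intro τ
    rw [h.orb_eq_zero, h'.orb_eq_zero]
    constructor
    · intro H t'
      obtain ⟨t, e1, e2⟩ := h2 t'
      rw [← e1, ← e2]; exact H t
    · intro H t
      obtain ⟨t', e1, e2⟩ := h1 t
      rw [← e1, ← e2]; exact H t'
  obtain ⟨g, hg1, hl, hr, hd⟩ :=
    exists_hom_of_isGen hg h.gen_mem h'.gen_mem (fun τ => (hker τ).1)
  refine isomorphic_of_bijective g ⟨?_, ?_⟩ hl hr (fun d m hm => by simpa using hd d m hm)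
  · rw [injective_iff_map_eq_zero]
    intro m hm
    obtain ⟨τ, rfl⟩ := hg m
    rw [hg1] at hm
    exact (hker τ).2 hm
  · intro n
    obtain ⟨τ, rfl⟩ := hg' n
    exact ⟨_, hg1 τ⟩

/-- A function `f` annihilating `M` sends the generator to `0`, while its action there has value `f
(r t) * 1` at `t`. -/
theorem IsModel.mem_rightVar (h : IsModel M m₀ l r φ) (t : T) : (r t : V) ∈ M.rightVar := by
  refine ⟨(r t).2, fun f hf => ?_⟩
  have h1 : φ ((0 : Module.End k M.carrier) m₀) t = f (r t) * φ m₀ t := hf ▸ h.right f m₀ t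
  rw [h.gen] at h1
  simpa using h1.symm

theorem IsModel.mem_leftVar (h : IsModel M m₀ l r φ) (t : T) : (l t : V) ∈ M.leftVar := by
  refine ⟨(l t).2, fun f hf => ?_⟩
  have h1 : φ ((0 : Module.End k M.carrier) m₀) t = f (l t) * φ m₀ t := hf ▸ h.left f m₀ t
  rw [h.gen] at h1
  simpa using h1.symm

/-- Since `φ` is injective, a function vanishing on the image of `r` annihilates `M`. Together with
`IsModel.mem_rightVar` this says that `V_M^r` is the Zariski closure in `Z` of the image of `r`. -/
theorem IsModel.eq_zero_of_mem_rightVar (h : IsModel M m₀ l r φ) {f : (regAlg Z hZ).carrier}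
    (hf : ∀ t, ev (r t) f = 0) (x : Z) (hx : (x : V) ∈ M.rightVar) : ev x f = 0 := by
  obtain ⟨hx₀, hx'⟩ := hx
  refine hx' f (LinearMap.ext fun m => h.inj (funext fun t => ?_))
  refine (h.right f m t).trans ?_
  rw [hf, zero_mul, LinearMap.zero_apply, map_zero]; rfl

theorem IsModel.eq_zero_of_mem_leftVar (h : IsModel M m₀ l r φ) {f : (regAlg Z hZ).carrier}
    (hf : ∀ t, ev (l t) f = 0) (x : Z) (hx : (x : V) ∈ M.leftVar) : ev x f = 0 := by
  obtain ⟨hx₀, hx'⟩ := hx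
  refine hx' f (LinearMap.ext fun m => h.inj (funext fun t => ?_))
  refine (h.left f m t).trans ?_
  rw [hf, zero_mul, LinearMap.zero_apply, map_zero]; rfl

/-- A regular function vanishing on a line minus the origin vanishes at the origin. -/
theorem ev_eq_zero_of_forall_smul {x y : Z} (hy : (y : V) = 0) {f : (regAlg Z hZ).carrier}
    (hf : ∀ c : k, c ≠ 0 → ev (⟨c • (x : V), hZ c x x.2⟩ : Z) f = 0) : ev y f = 0 := by
  have H : ∃ P : Polynomial k, ∀ c : k, ev (⟨c • (x : V), hZ c x x.2⟩ : Z) f = P.eval c := by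
    refine isInternal_induction (regAlg Z hZ).isInternal f (C := fun f => ∃ P : Polynomial k,
      ∀ c : k, ev (⟨c • (x : V), hZ c x x.2⟩ : Z) f = P.eval c) ?_ ⟨0, by simp⟩ ?_
    · intro d f hf
      obtain ⟨m, hm⟩ := regDeg_homothety (k := k) (X := Z) d
      refine ⟨Polynomial.X ^ m * Polynomial.C (ev x f), fun c => ?_⟩
      rw [Polynomial.eval_mul, Polynomial.eval_pow, Polynomial.eval_X, Polynomial.eval_C]
      exact hm f hf c x _ rfl
    · rintro f g ⟨P, hP⟩ ⟨Q, hQ⟩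
      exact ⟨P + Q, fun c => by rw [map_add, hP, hQ, Polynomial.eval_add]⟩
  obtain ⟨P, hP⟩ := H
  -- The factor `X` takes care of `c = 0`, where nothing is known about `P`; it is cancelled
  -- afterwards.
  have h0 : Polynomial.X * P = 0 := by
    refine Polynomial.funext fun c => ?_
    rw [Polynomial.eval_mul, Polynomial.eval_X, Polynomial.eval_zero, ← hP]
    by_cases hc : c = 0
    · rw [hc, zero_mul]
    · rw [hf c hc, mul_zero]
  have hP0 : P = 0 := (mul_eq_zero.1 h0).resolve_left Polynomial.X_ne_zero
  have h1 := hP 0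
  rw [hP0, Polynomial.eval_zero] at h1
  rw [← h1]
  congr 2
  exact Subtype.ext (by simp [hy])

/-! ### The product -/

variable (M N)

/-- The middle factor of `M ∗ N`. -/
abbrev mid : GrBimod (regAlg Z hZ) (regAlg Z hZ) :=
  regBimod hZ (M.rightVar ∩ N.leftVar)
    (fun c v hv => ⟨M.rightVar_isCone c v hv.1, N.leftVar_isCone c v hv.2⟩)
    (fun _ hv => hv.1.1)

theorem inter_subset : M.rightVar ∩ N.leftVar ⊆ Z := fun _ hv => hv.1.1

/-- The restriction map to the middle factor of `M ∗ N`. -/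
def toMid : (regAlg Z hZ).carrier →ₗ[k] (mid M N).carrier :=
  (res (k := k) (inter_subset M N)).toLinearMap

theorem toMid_surjective : Function.Surjective (toMid M N) := res_surjective (inter_subset M N)

theorem toMid_eq_zero (f : (regAlg Z hZ).carrier)
    (hf : ∀ x : Z, (x : V) ∈ M.rightVar → (x : V) ∈ N.leftVar → ev x f = 0) : toMid M N f = 0 :=
  Reg.ext fun x => hf ⟨x, x.2.1.1⟩ x.2.1 x.2.2

theorem left_toMid (f g : (regAlg Z hZ).carrier) :
    (mid M N).left f (toMid M N g) = toMid M N (f * g) :=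
  (map_mul (res (k := k) (inter_subset M N)) f g).symm

theorem right_toMid (f g : (regAlg Z hZ).carrier) :
    (mid M N).right f (toMid M N g) = toMid M N (f * g) :=
  (map_mul (res (k := k) (inter_subset M N)) f g).symm

/-- The map `m ↦ m ⊗ 1` to the product of `M` and the middle factor of `M ∗ N`. -/
def tmulMid : M.carrier →ₗ[k] (M.tens (mid M N)).carrier := (tmul M (mid M N)).flip (toMid M N 1)

theorem tmul_toMid (f : (regAlg Z hZ).carrier) (m : M.carrier) :
    tmul M (mid M N) m (toMid M N f) = tmulMid M N (M.right f m) := by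
  have h := tmul_balanced M (mid M N) m f (toMid M N 1)
  rw [left_toMid, mul_one] at h
  exact h.symm

theorem right_tmulMid (f : (regAlg Z hZ).carrier) (m : M.carrier) :
    (M.tens (mid M N)).right f (tmulMid M N m) = tmulMid M N (M.right f m) := by
  rw [← tmul_toMid, ← mul_one f, ← right_toMid, mul_one]; rfl

/-- The bilinear map `(m, n) ↦ m ⊗ 1 ⊗ n` to `M ∗ N`. -/
def st : M.carrier →ₗ[k] N.carrier →ₗ[k] (M.star N).carrier :=
  (tmul (M.tens (mid M N)) N).comp (tmulMid M N)

theorem st_apply (m : M.carrier) (n : N.carrier) :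
    st M N m n = tmul (M.tens (mid M N)) N (tmulMid M N m) n := rfl

theorem left_st (a : (regAlg Z hZ).carrier) (m : M.carrier) (n : N.carrier) :
    (M.star N).left a (st M N m n) = st M N (M.left a m) n := rfl

theorem right_st (a : (regAlg Z hZ).carrier) (m : M.carrier) (n : N.carrier) :
    (M.star N).right a (st M N m n) = st M N m (N.right a n) := rfl

theorem st_balanced (f : (regAlg Z hZ).carrier) (m : M.carrier) (n : N.carrier) :
    st M N (M.right f m) n = st M N m (N.left f n) := by
  rw [st_apply, st_apply, ← tmul_balanced, right_tmulMid]

/-- Here the middle factor matters: `f` can be placed in `𝒪(V_M^r ∩ V_N^ℓ)`, where it is already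
zero as a function, although it need not annihilate `M` or `N`. -/
theorem st_eq_zero (f : (regAlg Z hZ).carrier)
    (hf : ∀ x : Z, (x : V) ∈ M.rightVar → (x : V) ∈ N.leftVar → ev x f = 0)
    (m : M.carrier) (n : N.carrier) : st M N (M.right f m) n = 0 := by
  have h : tmulMid M N (M.right f m) = 0 := by
    rw [← tmul_toMid, toMid_eq_zero M N f hf, map_zero]; rfl
  rw [st_apply, h, map_zero, LinearMap.zero_apply]; rfl

theorem st_congr (f g : (regAlg Z hZ).carrier)
    (hf : ∀ x : Z, (x : V) ∈ M.rightVar → (x : V) ∈ N.leftVar → ev x f = ev x g)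
    (m : M.carrier) (n : N.carrier) : st M N (M.right f m) n = st M N (M.right g m) n := by
  have h := st_eq_zero M N (f - g) (fun x h h' => by rw [map_sub, hf x h h', sub_self]) m n
  rwa [map_sub, LinearMap.sub_apply, map_sub, LinearMap.sub_apply, sub_eq_zero] at h

theorem st_mem {i j : ℤ} {m : M.carrier} {n : N.carrier} (hm : m ∈ M.deg i) (hn : n ∈ N.deg j) :
    st M N m n ∈ (M.star N).deg (i + j) := by
  have h1 : toMid M N 1 ∈ (mid M N).deg 0 := by
    have : toMid M N 1 = (1 : Reg k (M.rightVar ∩ N.leftVar : Set V)) :=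
      map_one (res (k := k) (inter_subset M N))
    rw [this]
    exact SetLike.one_mem_graded (regDeg k (M.rightVar ∩ N.leftVar : Set V))
  have := tensDeg_tmul (M.tens (mid M N)) N (tensDeg_tmul M (mid M N) hm h1) hn
  rwa [add_zero] at this

variable {M N}

@[elab_as_elim]
theorem star_induction {P : (M.star N).carrier → Prop} (t : (M.star N).carrier) (h0 : P 0)
    (hadd : ∀ x y, P x → P y → P (x + y)) (h : ∀ m n, P (st M N m n)) : P t := by
  refine tens_induction (M.tens (mid M N)) N (P := P) t h0 hadd fun u n => ?_
  refine tens_induction M (mid M N) (P := fun u => P (tmul (M.tens (mid M N)) N u n)) u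
    ?_ (fun x y hx hy => ?_) fun m f => ?_
  · have h := LinearMap.congr_fun (map_zero (tmul (M.tens (mid M N)) N)) n
    exact h ▸ h0
  · have h := LinearMap.congr_fun (map_add (tmul (M.tens (mid M N)) N) x y) n
    exact h ▸ hadd _ _ hx hy
  obtain ⟨f, rfl⟩ := toMid_surjective M N f
  rw [tmul_toMid]
  exact h _ n

/-- The bimodule map from `M ∗ N` to functions on the fibre product of the two supports. -/
theorem IsModel.exists_star (h : IsModel M m₀ l r φ) (h' : IsModel N n₀ l' r' φ') :
    ∃ Φ : (M.star N).carrier →ₗ[k] {p : T × T' // r p.1 = l' p.2} → k,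
      ∀ m n p, Φ (st M N m n) p = φ m p.1.1 * φ' n p.1.2 := by
  -- A point of the fibre product lies over a point of `V_M^r ∩ V_N^ℓ`, at which elements of the
  -- middle factor can be evaluated.
  have hmem : ∀ p : {p : T × T' // r p.1 = l' p.2},
      (r p.1.1 : V) ∈ M.rightVar ∩ N.leftVar := fun p =>
    ⟨h.mem_rightVar _, p.2 ▸ h'.mem_leftVar _⟩
  let evm : ∀ p : {p : T × T' // r p.1 = l' p.2}, (mid M N).carrier →ₗ[k] k := fun p =>
    (Reg.eval (⟨_, hmem p⟩ : (M.rightVar ∩ N.leftVar : Set V))).toLinearMap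
  have hl : ∀ p f g, evm p ((mid M N).left f g) = ev (r p.1.1) f * evm p g :=
    fun p f g => rfl
  have hr : ∀ p f g, evm p ((mid M N).right f g) = ev (r p.1.1) f * evm p g :=
    fun p f g => rfl
  obtain ⟨Ψ, hΨ⟩ := exists_tens_lift M (mid M N)
    (W := {p : T × T' // r p.1 = l' p.2} → k)
    (LinearMap.mk₂ k (fun m f p => φ m p.1.1 * evm p f)
      (fun m m' f => funext fun p => by simp [add_mul])
      (fun c m f => funext fun p => by simp [mul_assoc])
      (fun m f f' => funext fun p => by simp [mul_add])
      (fun c m f => funext fun p => by simp [mul_left_comm]))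
    (fun b m f => funext fun p => by simp [hl, h.right, mul_left_comm, mul_assoc])
  have hΨr : ∀ b u p, Ψ ((M.tens (mid M N)).right b u) p = ev (r p.1.1) b * Ψ u p := by
    intro b u p
    refine tens_induction M (mid M N) (P := fun u : (M.tens (mid M N)).carrier =>
      Ψ ((M.tens (mid M N)).right b u) p = ev (r p.1.1) b * Ψ u p) u ?_ ?_ ?_
    · have h0 : Ψ ((M.tens (mid M N)).right b 0) p = ev (r p.1.1) b * Ψ 0 p := by simp
      exact h0
    · intro x y hx hy
      have h0 : ∀ x y : (M.tens (mid M N)).carrier,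
          Ψ ((M.tens (mid M N)).right b x) p = ev (r p.1.1) b * Ψ x p →
          Ψ ((M.tens (mid M N)).right b y) p = ev (r p.1.1) b * Ψ y p →
          Ψ ((M.tens (mid M N)).right b (x + y)) p = ev (r p.1.1) b * Ψ (x + y) p := by
        intro x y hx hy
        simp only [map_add, Pi.add_apply, hx, hy, mul_add]
      exact h0 x y hx hy
    · intro m f
      rw [tens_right_tmul]
      refine (congrFun (hΨ _ _) p).trans ?_
      rw [congrFun (hΨ _ _) p]
      simp [hr, mul_left_comm]
  obtain ⟨Φ, hΦ⟩ := exists_tens_lift (M.tens (mid M N)) N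
    (W := {p : T × T' // r p.1 = l' p.2} → k)
    (LinearMap.mk₂ k (fun u n p => Ψ u p * φ' n p.1.2)
      (fun m m' f => funext fun p => by simp [add_mul])
      (fun c m f => funext fun p => by simp [mul_assoc])
      (fun m f f' => funext fun p => by simp [mul_add])
      (fun c m f => funext fun p => by simp [mul_left_comm]))
    (fun b u n => funext fun p => by simp [hΨr, h'.left, p.2, mul_left_comm, mul_assoc])
  refine ⟨Φ, fun m n p => ?_⟩
  rw [st_apply]
  refine (congrFun (hΦ _ _) p).trans ?_
  have h1 : Ψ (tmulMid M N m) p = φ m p.1.1 * evm p (toMid M N 1) := congrFun (hΨ _ _) p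
  have h2 : evm p (toMid M N 1) = 1 := rfl
  change Ψ (tmulMid M N m) p * φ' n p.1.2 = _
  rw [h1, h2, mul_one]

/-- `m₀` and `β m₀` generate `M` as a right module. -/
def RGen (M : GrBimod (regAlg Z hZ) (regAlg Z hZ)) (m₀ : M.carrier) (β : (regAlg Z hZ).carrier) :
    Prop :=
  ∀ m, ∃ b b', m = M.right b m₀ + M.right b' (M.left β m₀)

/-- `m₀` and `m₀ β` generate `M` as a left module. -/
def LGen (M : GrBimod (regAlg Z hZ) (regAlg Z hZ)) (m₀ : M.carrier) (β : (regAlg Z hZ).carrier) :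
    Prop :=
  ∀ m, ∃ a a', m = M.left a m₀ + M.left a' (M.right β m₀)

/-- The left and right actions commute, so it suffices to rewrite `a m₀`; the right factor of `a m₀
b` is then absorbed into the coefficients. -/
theorem RGen.of_left {β : (regAlg Z hZ).carrier} (hg : M.IsGen m₀)
    (h : ∀ a, ∃ b b', M.left a m₀ = M.right b m₀ + M.right b' (M.left β m₀)) :
    RGen M m₀ β := by
  intro m
  refine isGen_induction hg m ⟨0, 0, by simp⟩ ?_ fun a b => ?_
  · rintro _ _ ⟨b, b', rfl⟩ ⟨c, c', rfl⟩
    exact ⟨b + c, b' + c', by simp only [map_add, LinearMap.add_apply]; abel⟩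
  · obtain ⟨c, c', h⟩ := h a
    exact ⟨b * c, b * c', by rw [M.comm, h, map_add, map_mul, map_mul]; rfl⟩

theorem LGen.of_right {β : (regAlg Z hZ).carrier} (hg : M.IsGen m₀)
    (h : ∀ a, ∃ b b', M.right a m₀ = M.left b m₀ + M.left b' (M.right β m₀)) :
    LGen M m₀ β := by
  intro m
  refine isGen_induction hg m ⟨0, 0, by simp⟩ ?_ fun a b => ?_
  · rintro _ _ ⟨b, b', rfl⟩ ⟨c, c', rfl⟩
    exact ⟨b + c, b' + c', by simp only [map_add, LinearMap.add_apply]; abel⟩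
  · obtain ⟨c, c', h⟩ := h b
    exact ⟨a * c, a * c', by rw [h, map_add, map_mul, map_mul]; rfl⟩

/-- If both factors are generated by two elements which are separated by the fibres over a dense
set `G` of points, then `M ∗ N` is a bimodule of functions. -/
theorem IsModel.star (h : IsModel M m₀ l r φ) (h' : IsModel N n₀ l' r' φ')
    {β β' : (regAlg Z hZ).carrier} (hM : RGen M m₀ β) (hN : LGen N n₀ β') (G : Set Z)
    (hG : ∀ f : (regAlg Z hZ).carrier, (∀ y ∈ G, ev y f = 0) →
      ∀ x : Z, (x : V) ∈ M.rightVar → (x : V) ∈ N.leftVar → ev x f = 0)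
    (hr : ∀ y ∈ G, ∃ t₁ t₂, r t₁ = y ∧ r t₂ = y ∧ ev (l t₁) β ≠ ev (l t₂) β)
    (hl : ∀ y ∈ G, ∃ t₁ t₂, l' t₁ = y ∧ l' t₂ = y ∧ ev (r' t₁) β' ≠ ev (r' t₂) β') :
    ∃ Φ, IsModel (M.star N) (st M N m₀ n₀)
      (fun p : {p : T × T' // r p.1 = l' p.2} => l p.1.1) (fun p => r' p.1.2) Φ ∧
      ∀ m n p, Φ (st M N m n) p = φ m p.1.1 * φ' n p.1.2 := by
  obtain ⟨Φ, hΦ⟩ := h.exists_star h'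
  refine ⟨Φ, ⟨fun a u p => ?_, fun b u p => ?_, fun p => ?_, ?_, ?_⟩, hΦ⟩
  · refine star_induction u (by simp)
      (fun x y hx hy => by simp only [map_add, Pi.add_apply, hx, hy, mul_add]) fun m n => ?_
    rw [left_st, hΦ, hΦ, h.left, mul_assoc]
  · refine star_induction u (by simp)
      (fun x y hx hy => by simp only [map_add, Pi.add_apply, hx, hy, mul_add]) fun m n => ?_
    rw [right_st, hΦ, hΦ, h'.right, mul_left_comm]
  · rw [hΦ, h.gen, h'.gen, mul_one]
  · rw [injective_iff_map_eq_zero]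
    intro u hu
    -- Right coefficients of `M` and left coefficients of `N` both move to the middle. Four products
    -- of generators remain, with coefficients that are functions of the middle point.
    have hform : ∃ f₀ f₁ f₂ f₃ : (regAlg Z hZ).carrier,
        u = st M N (M.right f₀ m₀) n₀ + st M N (M.right f₁ (M.left β m₀)) n₀ +
          st M N (M.right f₂ m₀) (N.right β' n₀) +
          st M N (M.right f₃ (M.left β m₀)) (N.right β' n₀) := by
      refine star_induction u ⟨0, 0, 0, 0, by simp⟩ ?_ fun m n => ?_
      · rintro _ _ ⟨f₀, f₁, f₂, f₃, rfl⟩ ⟨g₀, g₁, g₂, g₃, rfl⟩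
        exact ⟨f₀ + g₀, f₁ + g₁, f₂ + g₂, f₃ + g₃,
          by simp only [map_add, LinearMap.add_apply]; abel⟩
      · obtain ⟨b, b', rfl⟩ := hM m
        obtain ⟨a, a', rfl⟩ := hN n
        refine ⟨a * b, a * b', a' * b, a' * b', ?_⟩
        simp only [map_add, LinearMap.add_apply, ← st_balanced, map_mul, Module.End.mul_apply]
        abel
    obtain ⟨f₀, f₁, f₂, f₃, rfl⟩ := hform
    have key : ∀ p : {p : T × T' // r p.1 = l' p.2}, ev (r p.1.1) f₀ +
        ev (r p.1.1) f₁ * ev (l p.1.1) β + ev (r p.1.1) f₂ * ev (r' p.1.2) β' +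
        ev (r p.1.1) f₃ * ev (l p.1.1) β * ev (r' p.1.2) β' = 0 := by
      intro p
      have := congrFun hu p
      simpa only [map_add, Pi.add_apply, hΦ, h.right, h.left, h'.right, h.gen, h'.gen, mul_one,
        Pi.zero_apply] using this
    -- Over `y` there are four points of the fibre product. The resulting linear system in the
    -- `fᵢ(y)` is the tensor product of two Vandermonde systems, with determinants `A₂ - A₁` and `B₂
    -- - B₁` up to sign.
    have hz : ∀ y ∈ G, ev y f₀ = 0 ∧ ev y f₁ = 0 ∧ ev y f₂ = 0 ∧ ev y f₃ = 0 := by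
      intro y hy
      obtain ⟨t₁, t₂, e₁, e₂, hne⟩ := hr y hy
      obtain ⟨s₁, s₂, e₁', e₂', hne'⟩ := hl y hy
      have k₁ := key ⟨(t₁, s₁), e₁.trans e₁'.symm⟩
      have k₂ := key ⟨(t₁, s₂), e₁.trans e₂'.symm⟩
      have k₃ := key ⟨(t₂, s₁), e₂.trans e₁'.symm⟩
      have k₄ := key ⟨(t₂, s₂), e₂.trans e₂'.symm⟩
      simp only [e₁, e₂] at k₁ k₂ k₃ k₄
      set A₁ := ev (l t₁) β
      set A₂ := ev (l t₂) β
      set B₁ := ev (r' s₁) β'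
      set B₂ := ev (r' s₂) β'
      have hA : A₁ - A₂ ≠ 0 := sub_ne_zero.2 hne
      have hB : B₁ - B₂ ≠ 0 := sub_ne_zero.2 hne'
      have h3 : ev y f₃ = 0 := by
        refine (mul_eq_zero.1 ?_).resolve_right (mul_ne_zero hA hB)
        linear_combination k₁ - k₂ - k₃ + k₄
      have h2 : ev y f₂ = 0 := by
        refine (mul_eq_zero.1 ?_).resolve_right hB
        linear_combination k₁ - k₂ - A₁ * (B₁ - B₂) * h3
      have h1 : ev y f₁ = 0 := by
        refine (mul_eq_zero.1 ?_).resolve_right hA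
        linear_combination k₁ - k₃ - B₁ * (A₁ - A₂) * h3
      refine ⟨?_, h1, h2, h3⟩
      linear_combination k₁ - A₁ * h1 - B₁ * h2 - A₁ * B₁ * h3
    rw [st_eq_zero M N f₀ (hG f₀ fun y hy => (hz y hy).1),
      st_eq_zero M N f₁ (hG f₁ fun y hy => (hz y hy).2.1),
      st_eq_zero M N f₂ (hG f₂ fun y hy => (hz y hy).2.2.1),
      st_eq_zero M N f₃ (hG f₃ fun y hy => (hz y hy).2.2.2)]
    simp
  · simpa using st_mem M N h.gen_mem h'.gen_mem

/-- For `m = a m₀ b` and `n = a' n₀ b'`, the inner factors `b` and `a'` merge into one function in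
the middle, and `a`, `b'` act from outside. So only the elements `m₀ f ⊗ n₀` need to be tested. -/
theorem star_mem_of_isGen (h : M.IsGen m₀) (h' : N.IsGen n₀) {S : Submodule k (M.star N).carrier}
    (hl : ∀ a, ∀ u ∈ S, (M.star N).left a u ∈ S) (hr : ∀ b, ∀ u ∈ S, (M.star N).right b u ∈ S)
    (hmid : ∀ f, st M N (M.right f m₀) n₀ ∈ S) (u : (M.star N).carrier) : u ∈ S := by
  refine star_induction u (zero_mem _) (fun _ _ => add_mem) fun m n => ?_
  refine isGen_induction h m (by simp)
    (fun x y hx hy => by simpa using add_mem hx hy) fun a b => ?_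
  refine isGen_induction h' n (by simp)
    (fun x y hx hy => by simpa using add_mem hx hy) fun a' b' => ?_
  rw [N.comm, ← left_st, ← right_st, ← st_balanced, ← Module.End.mul_apply (M.right a'), ← map_mul]
  exact hl _ _ (hr _ _ (hmid _))

/-- If the middle factor is generated by `1` as a bimodule, then the product of cyclic bimodules is
cyclic. -/
theorem IsGen.star (h : M.IsGen m₀) (h' : N.IsGen n₀)
    (hmid : ∀ f, st M N (M.right f m₀) n₀ ∈
      LinearMap.range ((M.star N).orb (st M N m₀ n₀))) :
    (M.star N).IsGen (st M N m₀ n₀) := by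
  intro u
  refine star_mem_of_isGen h h' (S := LinearMap.range ((M.star N).orb (st M N m₀ n₀)))
    ?_ ?_ hmid u
  · rintro a _ ⟨τ, rfl⟩
    rw [left_orb]; exact ⟨_, rfl⟩
  · rintro a _ ⟨τ, rfl⟩
    rw [right_orb]; exact ⟨_, rfl⟩

theorem IsGen.star_of_left (h : M.IsGen m₀) (h' : N.IsGen n₀)
    (hmid : ∀ f, ∃ a, st M N (M.right f m₀) n₀ = st M N (M.left a m₀) n₀) :
    (M.star N).IsGen (st M N m₀ n₀) := by
  refine IsGen.star h h' fun f => ?_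
  obtain ⟨a, e⟩ := hmid f
  exact ⟨a ⊗ₜ 1, by rw [e, orb_tmul, map_one]; rfl⟩

theorem IsGen.star_of_right (h : M.IsGen m₀) (h' : N.IsGen n₀)
    (hmid : ∀ f, ∃ b, st M N m₀ (N.left f n₀) = st M N m₀ (N.right b n₀)) :
    (M.star N).IsGen (st M N m₀ n₀) := by
  refine IsGen.star h h' fun f => ?_
  obtain ⟨b, e⟩ := hmid f
  exact ⟨1 ⊗ₜ b, by rw [st_balanced, e, orb_tmul, map_one]; rfl⟩

end Models

end GrBimod

open GrBimod Equiv

/-! ### Points of the Weyl lines and the reflections acting on them -/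

section WeylPoints

variable {k : Type u} [Field k] {n : ℕ}

theorem act_apply (w : Perm (Fin (n + 1))) (v : Geom k n) (i : Fin (n + 1)) :
    (act k w v).1 i = v.1 (w⁻¹ i) := rfl

theorem act_swap_apply (a b : Fin (n + 1)) (v : Geom k n) (i : Fin (n + 1)) :
    (act k (swap a b) v).1 i = v.1 (swap a b i) := by
  rw [act_apply, swap_inv]

theorem act_swap_eq_iff {a b : Fin (n + 1)} {v : Geom k n} :
    act k (swap a b) v = v ↔ v.1 a = v.1 b := by
  constructor
  · intro h
    have := act_swap_apply a b v b
    rwa [h, swap_apply_right, eq_comm] at this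
  · intro h
    refine Subtype.ext (funext fun i => ?_)
    rw [act_swap_apply]
    rcases eq_or_ne i a with rfl | hia
    · rw [swap_apply_left, h]
    rcases eq_or_ne i b with rfl | hib
    · rw [swap_apply_right, h]
    rw [swap_apply_of_ne_of_ne hia hib]

theorem act_act_swap (a b : Fin (n + 1)) (v : Geom k n) :
    act k (swap a b) (act k (swap a b) v) = v := by
  rw [← act_mul, swap_mul_self, act_one]

theorem act_mem_weylZ (w : Perm (Fin (n + 1))) {v : Geom k n} (hv : v ∈ weylZ k n) :
    act k w v ∈ weylZ k n := by
  obtain ⟨ℓ, hℓ, hv⟩ := hv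
  exact ⟨_, isWeylLine_map k hℓ w, v, hv, rfl⟩

/-- The action of a permutation on the union of the Weyl lines. -/
def actZ (w : Perm (Fin (n + 1))) (x : weylZ k n) : weylZ k n :=
  ⟨act k w x, act_mem_weylZ w x.2⟩

theorem actZ_swap_eq_iff {a b : Fin (n + 1)} {x : weylZ k n} :
    actZ (swap a b) x = x ↔ x.1.1 a = x.1.1 b := by
  rw [← act_swap_eq_iff]
  exact Subtype.ext_iff

theorem actZ_swap_apply (a b : Fin (n + 1)) (x : weylZ k n) (i : Fin (n + 1)) :
    (actZ (swap a b) x).1.1 i = x.1.1 (swap a b i) := act_swap_apply a b x.1 i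

theorem actZ_actZ_swap (a b : Fin (n + 1)) (x : weylZ k n) :
    actZ (swap a b) (actZ (swap a b) x) = x := Subtype.ext (act_act_swap a b x.1)

theorem actZ_swap_ne {a b : Fin (n + 1)} {x : weylZ k n} (hx : actZ (swap a b) x ≠ x) :
    actZ (swap a b) (actZ (swap a b) x) ≠ actZ (swap a b) x := by
  rw [actZ_actZ_swap]; exact hx.symm

theorem mem_of_mem_weylLine {ℓ : Submodule k (Geom k n)} (hℓ : IsWeylLine k ℓ) {v w : Geom k n}
    (hv : v ∈ ℓ) (hv0 : v ≠ 0) (hw : w ∈ ℓ) : ∃ c : k, c • v = w := by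
  obtain ⟨c, hc⟩ := exists_smul_eq_of_finrank_eq_one hℓ.1 (x := (⟨v, hv⟩ : ℓ))
    (by simpa using hv0) ⟨w, hw⟩
  exact ⟨c, congrArg Subtype.val hc⟩

theorem mem_weylV_of_act_ne {t : Perm (Fin (n + 1))} {v : Geom k n} (hv : v ∈ weylZ k n)
    (ht : act k t v ≠ v) : v ∈ weylV k t := by
  obtain ⟨ℓ, hℓ, hv⟩ := hv
  exact ⟨ℓ, hℓ, fun h => ht (h hv), hv⟩

/-- A nonzero point spans its Weyl line, so a reflection fixing it would fix the whole line. With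
`mem_weylV_of_act_ne`, the nonzero points of `V_t` are exactly the points of `Z` moved by `t`. -/
theorem act_ne_of_mem_weylV {t : Perm (Fin (n + 1))} {v : Geom k n} (hv : v ∈ weylV k t)
    (h0 : v ≠ 0) : act k t v ≠ v := by
  obtain ⟨ℓ, hℓ, ht, hv⟩ := hv
  refine fun h => ht fun w hw => ?_
  obtain ⟨c, rfl⟩ := mem_of_mem_weylLine hℓ hv h0 hw
  exact (hyp k t).smul_mem c h

/-- The vector of `V` which takes one value on `A` and another one off `A`. -/
theorem exists_twoValued (A : Finset (Fin (n + 1))) : ∃ v : Geom k n,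
    ∀ i, v.1 i = if i ∈ A then (n + 1 : k) - A.card else -A.card := by
  refine ⟨⟨fun i => if i ∈ A then (n + 1 : k) - A.card else -A.card, ?_⟩, fun i => rfl⟩
  rw [LinearMap.mem_ker, LinearMap.sum_apply]
  have : ∀ i, (if i ∈ A then (n + 1 : k) - A.card else -A.card) =
      (if i ∈ A then (n + 1 : k) else 0) - A.card := fun i => by split_ifs <;> ring
  simp only [LinearMap.proj_apply, this, Finset.sum_sub_distrib, Finset.sum_ite_mem,
    Finset.univ_inter, Finset.sum_const, Finset.card_univ, Fintype.card_fin, nsmul_eq_mul]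
  push_cast
  ring

/-- A Weyl line is determined by a subset of a finite group. Finiteness permits a product over lines
in `exists_ev_ne_zero`. -/
theorem finite_weylLines : {ℓ : Submodule k (Geom k n) | IsWeylLine k ℓ}.Finite := by
  refine (Set.finite_range fun S : Set (Perm (Fin (n + 1))) => ⨅ t ∈ S, hyp k t).subset ?_
  rintro _ ⟨-, S, -, rfl⟩
  exact ⟨S, rfl⟩

variable [CharZero k]

/-- A point of a Weyl line takes at most two values. -/
theorem weylZ_apply_eq {v : Geom k n} (hv : v ∈ weylZ k n) (a b c : Fin (n + 1)) :
    v.1 a = v.1 b ∨ v.1 b = v.1 c ∨ v.1 a = v.1 c := by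
  by_contra! h
  obtain ⟨hab, hbc, hac⟩ := h
  obtain ⟨ℓ, hℓ, hv⟩ := hv
  have hℓ' := hℓ
  obtain ⟨-, S, hS, rfl⟩ := hℓ
  classical
  -- The two-valued vector of the level set of `v` through `a`. It satisfies every equation `x_i =
  -- x_j` that `v` does, hence lies on the same line, but it does not separate `b` from `c`.
  obtain ⟨w, hw⟩ := exists_twoValued (k := k) (Finset.univ.filter fun i => v.1 i = v.1 a)
  have hwm : w ∈ ⨅ t ∈ S, hyp k t := by
    simp only [Submodule.mem_iInf] at hv ⊢
    intro t ht
    obtain ⟨x, y, -, rfl⟩ := hS t ht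
    have h1 : v.1 x = v.1 y := act_swap_eq_iff.1 (hv _ ht)
    refine act_swap_eq_iff.2 ?_
    simp only [hw, Finset.mem_filter, Finset.mem_univ, true_and, h1]
  have hv0 : v ≠ 0 := by rintro rfl; exact hab rfl
  obtain ⟨r, rfl⟩ := mem_of_mem_weylLine hℓ' hv hv0 hwm
  have e1 := hw a
  have e2 := hw b
  have e3 := hw c
  simp only [Finset.mem_filter, Finset.mem_univ, true_and, if_true, if_neg hab.symm,
    if_neg hac.symm] at e1 e2 e3
  change r * v.1 a = _ at e1
  change r * v.1 b = _ at e2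
  change r * v.1 c = _ at e3
  have h4 : r = 0 := by
    refine (mul_eq_zero.1 ?_).resolve_right (sub_ne_zero.2 hbc)
    linear_combination e2 - e3
  have h5 : (n + 1 : k) = 0 := by
    rw [h4] at e1 e2
    linear_combination e2 - e1
  exact absurd h5 (by exact_mod_cast Nat.succ_ne_zero n)

/-- A two-valued vector is a point of a Weyl line. -/
theorem exists_mem_weylZ (A : Finset (Fin (n + 1))) {p q : Fin (n + 1)} (hp : p ∈ A)
    (hq : q ∉ A) : ∃ x : weylZ k n, ∀ i j, x.1.1 i = x.1.1 j ↔ (i ∈ A ↔ j ∈ A) := by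
  obtain ⟨v, hv⟩ := exists_twoValued (k := k) A
  have hn : (n + 1 : k) ≠ 0 := by exact_mod_cast Nat.succ_ne_zero n
  have hvij : ∀ i j, v.1 i = v.1 j ↔ (i ∈ A ↔ j ∈ A) := by
    intro i j
    rw [hv, hv]
    by_cases hi : i ∈ A <;> by_cases hj : j ∈ A <;> simp [hi, hj, sub_eq_add_neg, hn]
  have hv0 : v ≠ 0 := by
    rintro rfl
    have := (hvij p q).1 rfl
    exact hq (this.1 hp)
  -- The transpositions preserving `A` cut out exactly the line of `v`: a vector they fix has one
  -- value on `A` and one off `A`, and the vanishing of its sum leaves one parameter.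
  refine ⟨⟨v, Submodule.span k {v}, ⟨finrank_span_singleton hv0,
    {t | ∃ i j, i ≠ j ∧ t = swap i j ∧ (i ∈ A ↔ j ∈ A)}, ?_, ?_⟩,
    Submodule.mem_span_singleton_self v⟩, hvij⟩
  · rintro _ ⟨i, j, hij, rfl, -⟩
    exact ⟨i, j, hij, rfl⟩
  · apply le_antisymm
    · rw [Submodule.span_singleton_le_iff_mem]
      simp only [Submodule.mem_iInf]
      rintro _ ⟨i, j, hij, rfl, h⟩
      exact act_swap_eq_iff.2 ((hvij i j).2 h)
    · intro u hu
      simp only [Submodule.mem_iInf] at hu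
      have hu' : ∀ i j, (i ∈ A ↔ j ∈ A) → u.1 i = u.1 j := by
        intro i j h
        rcases eq_or_ne i j with rfl | hij
        · rfl
        · exact act_swap_eq_iff.1 (hu _ ⟨i, j, hij, rfl, h⟩)
      have hval : ∀ i, u.1 i = if i ∈ A then u.1 p else u.1 q := by
        intro i
        split_ifs with hi
        · exact hu' i p (by simp [hi, hp])
        · exact hu' i q (by simp [hi, hq])
      have hsum : ∑ i, u.1 i = 0 := by
        have := u.2
        rwa [LinearMap.mem_ker, LinearMap.sum_apply] at this
      have hsum' : (A.card : k) * (u.1 p - u.1 q) + (n + 1) * u.1 q = 0 := by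
        have h2 : ∀ i, u.1 i = (if i ∈ A then u.1 p - u.1 q else 0) + u.1 q := by
          intro i; rw [hval i]; split_ifs <;> ring
        rw [Finset.sum_congr rfl fun i _ => h2 i, Finset.sum_add_distrib, Finset.sum_ite_mem,
          Finset.univ_inter, Finset.sum_const, Finset.sum_const, Finset.card_univ,
          Fintype.card_fin, nsmul_eq_mul, nsmul_eq_mul] at hsum
        exact_mod_cast hsum
      -- The two values of `v` differ by `n + 1`, so the scalar is the quotient of the differences.
      refine Submodule.mem_span_singleton.2 ⟨(u.1 p - u.1 q) / (n + 1), ?_⟩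
      refine Subtype.ext (funext fun i => ?_)
      change (u.1 p - u.1 q) / (n + 1) * v.1 i = u.1 i
      rw [hv, hval i]
      split_ifs
      · field_simp
        linear_combination -hsum'
      · field_simp
        linear_combination -hsum'

/-- A point of `Z` fixed by `t` is separated from the lines not fixed by `t`. -/
theorem exists_ev_ne_zero {t : Perm (Fin (n + 1))} {y : weylZ k n} (h0 : (y : Geom k n) ≠ 0)
    (ht : actZ t y = y) : ∃ f : (RBar k n).carrier, ev y f ≠ 0 ∧
      ∀ z : weylZ k n, actZ t z ≠ z → ev z f = 0 := by
  classical
  have hfin : {ℓ | IsWeylLine k ℓ ∧ y.1 ∉ ℓ}.Finite :=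
    (finite_weylLines (k := k) (n := n)).subset fun ℓ h => h.1
  have hφ : ∀ ℓ : Submodule k (Geom k n), ∃ φ : Module.Dual k (Geom k n),
      y.1 ∉ ℓ → φ y.1 ≠ 0 ∧ ∀ z ∈ ℓ, φ z = 0 := by
    intro ℓ
    by_cases h : y.1 ∈ ℓ
    · exact ⟨0, fun h' => absurd h h'⟩
    · obtain ⟨φ, h1, h2⟩ := Submodule.exists_le_ker_of_notMem h
      exact ⟨φ, fun _ => ⟨h1, fun z hz => h2 hz⟩⟩
  choose φ hφ using hφ
  have hev : ∀ (x : weylZ k n) ℓ,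
      ev x (show (RBar k n).carrier from linForm k (weylZ k n) (φ ℓ)) = φ ℓ x.1 :=
    fun _ _ => rfl
  -- One linear form for each Weyl line missing `y`, vanishing on that line but not at `y`. A line
  -- with a point moved by `t` misses `y`, because `t` fixes the line through `y`.
  refine ⟨∏ ℓ ∈ hfin.toFinset, (show (RBar k n).carrier from linForm k (weylZ k n) (φ ℓ)),
    ?_, fun z hz => ?_⟩
  · rw [map_prod, Finset.prod_ne_zero_iff]
    intro ℓ hℓ
    rw [Set.Finite.mem_toFinset] at hℓ
    rw [hev]
    exact (hφ ℓ hℓ.2).1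
  · obtain ⟨ℓ, hℓ, hzℓ⟩ := z.2
    have hy : y.1 ∉ ℓ := by
      intro hy
      obtain ⟨c, hc⟩ := mem_of_mem_weylLine hℓ hy h0 hzℓ
      refine hz (Subtype.ext ?_)
      change act k t z.1 = z.1
      rw [← hc, map_smul]
      exact congrArg (c • ·) (congrArg Subtype.val ht)
    rw [map_prod]
    refine Finset.prod_eq_zero (i := ℓ) ((Set.Finite.mem_toFinset _).2 ⟨hℓ, hy⟩) ?_
    rw [hev]
    exact (hφ ℓ hy).2 _ hzℓ

/-! ### Invariants -/

/-- Functions invariant under a permutation. -/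
def IsInv (t : Perm (Fin (n + 1))) (f : (RBar k n).carrier) : Prop :=
  ∀ x, ev (actZ t x) f = ev x f

theorem IsInv.add {t : Perm (Fin (n + 1))} {f g : (RBar k n).carrier} (hf : IsInv t f)
    (hg : IsInv t g) : IsInv t (f + g) := fun x => by rw [map_add, map_add, hf, hg]

theorem IsInv.mul {t : Perm (Fin (n + 1))} {f g : (RBar k n).carrier} (hf : IsInv t f)
    (hg : IsInv t g) : IsInv t (f * g) := fun x => by rw [map_mul, map_mul, hf, hg]

/-- The coordinate functions. -/
def coord (i : Fin (n + 1)) : (RBar k n).carrier :=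
  linForm k (weylZ k n) ((LinearMap.proj i).comp (Geom k n).subtype)

@[simp] theorem ev_coord (i : Fin (n + 1)) (x : weylZ k n) : ev x (coord i) = x.1.1 i := rfl

theorem coord_mem (i : Fin (n + 1)) : coord i ∈ (RBar k n).deg 2 := by
  have h := mem_regDeg (f := linForm k (weylZ k n) ((LinearMap.proj i).comp (Geom k n).subtype))
    (m := 1) (by rw [pow_one]; exact ⟨_, rfl⟩)
  rwa [Nat.cast_one, mul_one] at h

/-- The equation `x_a - x_b` of the reflecting hyperplane of `(a, b)`. -/
def root (a b : Fin (n + 1)) : (RBar k n).carrier := coord a - coord b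

theorem ev_root (a b : Fin (n + 1)) (x : weylZ k n) : ev x (root a b) = x.1.1 a - x.1.1 b := by
  rw [root, map_sub, ev_coord, ev_coord]

theorem root_mem (a b : Fin (n + 1)) : root a b ∈ (RBar k n).deg 2 :=
  sub_mem (coord_mem a) (coord_mem b)

theorem ev_actZ_root (a b : Fin (n + 1)) (x : weylZ k n) :
    ev (actZ (swap a b) x) (root a b) = - ev x (root a b) := by
  rw [ev_root, ev_root, actZ_swap_apply, actZ_swap_apply, swap_apply_left, swap_apply_right]; ring

theorem ev_root_ne_zero {a b : Fin (n + 1)} {x : weylZ k n} (hx : actZ (swap a b) x ≠ x) :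
    ev x (root a b) ≠ 0 := by
  rw [ev_root, sub_ne_zero]
  exact fun h => hx (actZ_swap_eq_iff.2 h)

theorem ev_root_ne {a b : Fin (n + 1)} {x : weylZ k n} (hx : actZ (swap a b) x ≠ x) :
    ev x (root a b) ≠ ev (actZ (swap a b) x) (root a b) := by
  rw [ev_actZ_root, Ne, eq_neg_iff_add_eq_zero, ← two_mul]
  exact mul_ne_zero two_ne_zero (ev_root_ne_zero hx)

/-- Every function is the sum of an invariant function and the product of `x_a - x_b` with an
invariant function. -/
theorem exists_inv_decomp (a b : Fin (n + 1)) (f : (RBar k n).carrier) :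
    ∃ f₀ f₁, IsInv (swap a b) f₀ ∧ IsInv (swap a b) f₁ ∧ f = f₀ + root a b * f₁ := by
  have key : ∀ f₀ : weylZ k n → k, f₀ ∈ regSubalg k (weylZ k n) →
      ∃ g₀ g₁ : (RBar k n).carrier, IsInv (swap a b) g₀ ∧ IsInv (swap a b) g₁ ∧
        ∀ x, f₀ x = ev x g₀ + ev x (root a b) * ev x g₁ := by
    intro f₀ hf₀
    refine Algebra.adjoin_induction (p := fun f₀ _ =>
      ∃ g₀ g₁ : (RBar k n).carrier, IsInv (swap a b) g₀ ∧ IsInv (swap a b) g₁ ∧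
        ∀ x, f₀ x = ev x g₀ + ev x (root a b) * ev x g₁) ?_ ?_ ?_ ?_ hf₀
    · rintro _ ⟨φ, rfl⟩
      have he : (Pi.single a 1 - Pi.single b 1 : Fin (n + 1) → k) ∈ Geom k n := by
        rw [LinearMap.mem_ker, LinearMap.sum_apply]
        simp
      set e : Geom k n := ⟨_, he⟩ with hedef
      -- The reflection formula with coroot `e`: it shows that the anti-invariant part of a linear
      -- form `φ` is `φ e / 2` times the root.
      have hact : ∀ v : Geom k n, act k (swap a b) v = v - (v.1 a - v.1 b) • e := by
        intro v
        refine Subtype.ext (funext fun i => ?_)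
        rw [act_swap_apply]
        change _ = v.1 i - (v.1 a - v.1 b) *
          ((Pi.single a 1 : Fin (n + 1) → k) i - (Pi.single b 1 : Fin (n + 1) → k) i)
        rcases eq_or_ne a b with rfl | hab
        · simp
        rcases eq_or_ne i a with rfl | hia
        · rw [swap_apply_left, Pi.single_eq_same, Pi.single_eq_of_ne hab]; ring
        rcases eq_or_ne i b with rfl | hib
        · rw [swap_apply_right, Pi.single_eq_same, Pi.single_eq_of_ne hab.symm]; ring
        rw [swap_apply_of_ne_of_ne hia hib, Pi.single_eq_of_ne hia, Pi.single_eq_of_ne hib]; ring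
      let g₀ : (RBar k n).carrier :=
        linForm k (weylZ k n) ((2⁻¹ : k) • (φ + φ.comp (act k (swap a b))))
      have hg₀ : ∀ x : weylZ k n, ev x g₀ = 2⁻¹ * (φ x.1 + φ (act k (swap a b) x.1)) :=
        fun x => rfl
      refine ⟨g₀, algebraMap k _ (2⁻¹ * φ e), fun x => ?_, fun x => by simp, fun x => ?_⟩
      · rw [hg₀, hg₀]
        change 2⁻¹ * (φ (act k (swap a b) x.1) + φ (act k (swap a b) (act k (swap a b) x.1))) = _
        rw [act_act_swap, add_comm]
      · rw [hg₀, ev_root, AlgHom.commutes, hact, map_sub, map_smul, smul_eq_mul]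
        change φ x.1 = 2⁻¹ * (φ x.1 + (φ x.1 - (x.1.1 a - x.1.1 b) * φ e)) +
          (x.1.1 a - x.1.1 b) * (2⁻¹ * φ e)
        field_simp
        ring
    · exact fun r => ⟨algebraMap k _ r, 0, fun x => by simp, fun x => by simp, fun x => by simp⟩
    · rintro f g _ _ ⟨f₀, f₁, h₀, h₁, h⟩ ⟨g₀, g₁, h₀', h₁', h'⟩
      refine ⟨f₀ + g₀, f₁ + g₁, h₀.add h₀', h₁.add h₁', fun x => ?_⟩
      rw [Pi.add_apply, h, h', map_add, map_add]; ring
    · rintro f g _ _ ⟨f₀, f₁, h₀, h₁, h⟩ ⟨g₀, g₁, h₀', h₁', h'⟩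
      -- Expansion of `(f₀ + α f₁)(g₀ + α g₁)`; the square of `α` is invariant, since the reflection
      -- changes the sign of `α`.
      refine ⟨f₀ * g₀ + root a b * root a b * (f₁ * g₁), f₀ * g₁ + f₁ * g₀,
        (h₀.mul h₀').add (IsInv.mul (fun x => ?_) (h₁.mul h₁')), (h₀.mul h₁').add (h₁.mul h₀'),
        fun x => ?_⟩
      · rw [map_mul, map_mul, ev_actZ_root, neg_mul_neg]
      · rw [Pi.mul_apply, h, h']
        simp only [map_add, map_mul]
        ring
  obtain ⟨g₀, g₁, h₀, h₁, h⟩ := key f.1 f.2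
  refine ⟨g₀, g₁, h₀, h₁, ev_ext fun x => ?_⟩
  rw [map_add, map_mul]
  exact h x

end WeylPoints

/-! ### The support of `B_t` in `Z × Z` -/

section Supp

variable {k : Type u} [Field k] {n : ℕ}

variable (k) in
/-- The union of the graphs of `1` and `t`, over the points not fixed by `t`. -/
def Supp (t : Perm (Fin (n + 1))) : Type u :=
  {p : weylZ k n × weylZ k n // actZ t p.1 ≠ p.1 ∧ (p.2 = p.1 ∨ p.2 = actZ t p.1)}

/-- The first projection. -/
def Supp.l {t : Perm (Fin (n + 1))} (p : Supp k t) : weylZ k n := p.1.1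

/-- The second projection. -/
def Supp.r {t : Perm (Fin (n + 1))} (p : Supp k t) : weylZ k n := p.1.2

theorem Supp.l_ne {t : Perm (Fin (n + 1))} (p : Supp k t) : actZ t p.l ≠ p.l := p.2.1

theorem Supp.r_eq {t : Perm (Fin (n + 1))} (p : Supp k t) : p.r = p.l ∨ p.r = actZ t p.l := p.2.2

theorem Supp.r_ne {a b : Fin (n + 1)} (p : Supp k (swap a b)) : actZ (swap a b) p.r ≠ p.r := by
  rcases p.r_eq with h | h
  · rw [h]; exact p.l_ne
  · rw [h]; exact actZ_swap_ne p.l_ne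

theorem exists_supp {t : Perm (Fin (n + 1))} {x y : weylZ k n} (hx : actZ t x ≠ x)
    (hy : y = x ∨ y = actZ t x) : ∃ p : Supp k t, p.l = x ∧ p.r = y := ⟨⟨(x, y), hx, hy⟩, rfl, rfl⟩

/-- The support is the graph of the group generated by a transposition, over points moved by it, so
it is closed under composition. -/
theorem Supp.exists_comp {a b : Fin (n + 1)} (p q : Supp k (swap a b)) (h : p.r = q.l) :
    ∃ w : Supp k (swap a b), w.l = p.l ∧ w.r = q.r := by
  apply exists_supp p.l_ne
  rcases p.r_eq with h1 | h1 <;> rcases q.r_eq with h2 | h2 <;> rw [h2, ← h, h1]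
  · exact Or.inl rfl
  · exact Or.inr rfl
  · exact Or.inr rfl
  · rw [actZ_actZ_swap]; exact Or.inl rfl

end Supp

/-! ### The bimodule `B_t` as functions on its support -/

section Bimodule

variable {k : Type u} [Field k] [CharZero k] {n : ℕ}

/-- A function which vanishes at the points not fixed by `t` vanishes on `V_t`. -/
theorem ev_eq_zero_of_mem_weylV {t : Perm (Fin (n + 1))} {f : (RBar k n).carrier}
    (hf : ∀ x, actZ t x ≠ x → ev x f = 0) (y : weylZ k n)
    (hy : (y : Geom k n) ∈ weylV k t) : ev y f = 0 := by
  by_cases h0 : (y : Geom k n) = 0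
  · obtain ⟨ℓ, hℓ, ht, -⟩ := hy
    obtain ⟨w, hw, hwt⟩ := SetLike.not_le_iff_exists.1 ht
    refine ev_eq_zero_of_forall_smul (x := (⟨w, ⟨ℓ, hℓ, hw⟩⟩ : weylZ k n)) h0 fun c hc =>
      hf _ fun h => hwt ?_
    have h1 : act k t (c • w) = c • w := congrArg Subtype.val h
    rw [map_smul] at h1
    exact smul_right_injective _ hc h1
  · exact hf _ fun h => act_ne_of_mem_weylV hy h0 (congrArg Subtype.val h)

/-- The left factor of the bimodule `𝒪(V_t) ⊗ 𝒪(V_t)`. -/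
abbrev facL (t : Perm (Fin (n + 1))) : GrBimod (RBar k n) (RTInv k t) :=
  GrBimod.ofAlgHom (RT k t) (res (weylV_subset k t)) (res_mem (weylV_subset k t))
    (inclInv k t) (fun _ _ h => h)

/-- The right factor of the bimodule `𝒪(V_t) ⊗ 𝒪(V_t)`. -/
abbrev facR (t : Perm (Fin (n + 1))) : GrBimod (RTInv k t) (RBar k n) :=
  GrBimod.ofAlgHom (RT k t) (inclInv k t) (fun _ _ h => h)
    (res (weylV_subset k t)) (res_mem (weylV_subset k t))

/-- Restriction from `Z` to `V_t`, as a map to the left factor. -/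
def resL (t : Perm (Fin (n + 1))) : (RBar k n).carrier →ₗ[k] (facL (k := k) t).carrier :=
  (res (k := k) (weylV_subset k t)).toLinearMap

/-- Restriction from `Z` to `V_t`, as a map to the right factor. -/
def resR (t : Perm (Fin (n + 1))) : (RBar k n).carrier →ₗ[k] (facR (k := k) t).carrier :=
  (res (k := k) (weylV_subset k t)).toLinearMap

theorem resL_surjective (t : Perm (Fin (n + 1))) : Function.Surjective (resL (k := k) t) :=
  res_surjective (weylV_subset k t)

theorem resR_surjective (t : Perm (Fin (n + 1))) : Function.Surjective (resR (k := k) t) :=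
  res_surjective (weylV_subset k t)

variable (k) in
/-- The generator `1 ⊗ 1` of the bimodule `𝒪(V_t) ⊗ 𝒪(V_t)`. -/
def genT (t : Perm (Fin (n + 1))) : (bimodT k t).carrier :=
  tmul (facL (k := k) t) (facR (k := k) t) (resL t 1) (resR t 1)

theorem left_resL (t : Perm (Fin (n + 1))) (f g : (RBar k n).carrier) :
    (facL (k := k) t).left f (resL t g) = resL t (f * g) :=
  (map_mul (res (k := k) (weylV_subset k t)) f g).symm

theorem right_resR (t : Perm (Fin (n + 1))) (f g : (RBar k n).carrier) :
    (facR (k := k) t).right f (resR t g) = resR t (f * g) :=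
  (map_mul (res (k := k) (weylV_subset k t)) f g).symm

theorem left_right_genT (t : Perm (Fin (n + 1))) (a b : (RBar k n).carrier) :
    (bimodT k t).left a ((bimodT k t).right b (genT k t)) =
      tmul (facL (k := k) t) (facR (k := k) t) (resL t a) (resR t b) := by
  have h1 : (bimodT k t).left a ((bimodT k t).right b (genT k t)) =
      tmul (facL (k := k) t) (facR (k := k) t) ((facL (k := k) t).left a (resL t 1))
        ((facR (k := k) t).right b (resR t 1)) := rfl
  rw [h1, left_resL, right_resR, mul_one, mul_one]

theorem isGen_genT (t : Perm (Fin (n + 1))) : (bimodT k t).IsGen (genT k t) := by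
  intro u
  change u ∈ LinearMap.range _
  refine tens_induction (facL (k := k) t) (facR (k := k) t)
    (P := fun u : (bimodT k t).carrier => u ∈ LinearMap.range ((bimodT k t).orb (genT k t))) u
    (zero_mem _) (fun _ _ => add_mem) fun a b => ?_
  obtain ⟨a, rfl⟩ := resL_surjective t a
  obtain ⟨b, rfl⟩ := resR_surjective t b
  rw [← left_right_genT, ← orb_tmul]
  exact ⟨_, rfl⟩

/-- An invariant function restricts to an element of `𝒪(V_t)^t`, over which the tensor product is
balanced. -/
theorem left_genT_of_isInv {t : Perm (Fin (n + 1))} {f : (RBar k n).carrier} (hf : IsInv t f) :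
    (bimodT k t).left f (genT k t) = (bimodT k t).right f (genT k t) := by
  have hfix : res (k := k) (weylV_subset k t) f ∈
      AlgHom.equalizer (pull (act k t) (mapsTo_weylV k t)) (AlgHom.id k _) :=
    Reg.ext fun x => hf ⟨x.1, weylV_subset k t x.2⟩
  let g : (RTInv k t).carrier := ⟨_, hfix⟩
  have h1 : (facL (k := k) t).right g (resL t 1) = (facL (k := k) t).left f (resL t 1) := rfl
  have h2 : (facR (k := k) t).left g (resR t 1) = (facR (k := k) t).right f (resR t 1) := rfl
  have h3 := tmul_balanced (facL (k := k) t) (facR (k := k) t) (resL t 1) g (resR t 1)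
  rw [h1, h2] at h3
  exact h3

theorem left_genT_eq_zero {t : Perm (Fin (n + 1))} {f : (RBar k n).carrier}
    (hf : ∀ x, actZ t x ≠ x → ev x f = 0) : (bimodT k t).left f (genT k t) = 0 := by
  have h : resL t f = 0 :=
    Reg.ext fun x => ev_eq_zero_of_mem_weylV hf ⟨x, weylV_subset k t x.2⟩ x.2
  have h1 := left_right_genT t f 1
  rw [map_one, Module.End.one_apply, h, map_zero] at h1
  exact h1

/-- The generators `1` and `α` of `𝒪(V_t)` over its invariants give two generators of `B_t` as a
right module. Invariance of the coefficients is recorded because products with adjacent reflections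
are rewritten further. -/
theorem left_genT (a b : Fin (n + 1)) (f : (RBar k n).carrier) :
    ∃ c c', IsInv (swap a b) c ∧ IsInv (swap a b) c' ∧
      (bimodT k (swap a b)).left f (genT k (swap a b)) =
        (bimodT k (swap a b)).right c (genT k (swap a b)) + (bimodT k (swap a b)).right c'
          ((bimodT k (swap a b)).left (root a b) (genT k (swap a b))) := by
  obtain ⟨c, c', h, h', rfl⟩ := exists_inv_decomp a b f
  refine ⟨c, c', h, h', ?_⟩
  rw [map_add, map_mul, LinearMap.add_apply, Module.End.mul_apply, left_genT_of_isInv h,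
    left_genT_of_isInv h', GrBimod.comm]

theorem right_genT (a b : Fin (n + 1)) (f : (RBar k n).carrier) :
    ∃ c c', IsInv (swap a b) c ∧ IsInv (swap a b) c' ∧
      (bimodT k (swap a b)).right f (genT k (swap a b)) =
        (bimodT k (swap a b)).left c (genT k (swap a b)) + (bimodT k (swap a b)).left c'
          ((bimodT k (swap a b)).right (root a b) (genT k (swap a b))) := by
  obtain ⟨c, c', h, h', rfl⟩ := exists_inv_decomp a b f
  refine ⟨c, c', h, h', ?_⟩
  rw [map_add, map_mul, LinearMap.add_apply, Module.End.mul_apply, ← left_genT_of_isInv h,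
    ← left_genT_of_isInv h', GrBimod.comm]

theorem rGen_genT (a b : Fin (n + 1)) :
    RGen (bimodT k (swap a b)) (genT k (swap a b)) (root a b) :=
  RGen.of_left (isGen_genT _) fun f => by
    obtain ⟨c, c', -, -, h⟩ := left_genT a b f
    exact ⟨c, c', h⟩

theorem lGen_genT (a b : Fin (n + 1)) :
    LGen (bimodT k (swap a b)) (genT k (swap a b)) (root a b) :=
  LGen.of_right (isGen_genT _) fun f => by
    obtain ⟨c, c', -, -, h⟩ := right_genT a b f
    exact ⟨c, c', h⟩

theorem Supp.sep_l {a b : Fin (n + 1)} (y : weylZ k n) (hy : actZ (swap a b) y ≠ y) :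
    ∃ p q : Supp k (swap a b), p.l = y ∧ q.l = y ∧ ev p.r (root a b) ≠ ev q.r (root a b) := by
  obtain ⟨p, hp, hp'⟩ := exists_supp hy (Or.inl rfl)
  obtain ⟨q, hq, hq'⟩ := exists_supp hy (Or.inr rfl)
  exact ⟨p, q, hp, hq, by rw [hp', hq']; exact ev_root_ne hy⟩

theorem Supp.sep_r {a b : Fin (n + 1)} (y : weylZ k n) (hy : actZ (swap a b) y ≠ y) :
    ∃ p q : Supp k (swap a b), p.r = y ∧ q.r = y ∧ ev p.l (root a b) ≠ ev q.l (root a b) := by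
  obtain ⟨p, hp, hp'⟩ := exists_supp hy (Or.inl rfl)
  obtain ⟨q, hq, hq'⟩ := exists_supp (actZ_swap_ne hy) (Or.inr (actZ_actZ_swap a b y).symm)
  exact ⟨p, q, hp', hq', by rw [hp, hq]; exact ev_root_ne hy⟩

/-- The tensor `f ⊗ f'` becomes the function `f(x) f'(y)`. It is balanced because invariants agree
at `x` and `y`. For injectivity, an element is `c (1 ⊗ 1) + c' (1 ⊗ α)`; evaluation at `(x, x)` and
`(x, t x)` separates the two terms, so `c` and `c'` vanish on the points moved by `t`, hence on
`V_t`. -/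
theorem exists_isModel_bimodT (a b : Fin (n + 1)) :
    ∃ φ, IsModel (bimodT k (swap a b)) (genT k (swap a b)) (T := Supp k (swap a b))
      Supp.l Supp.r φ := by
  set t := swap a b with ht
  let xl : Supp k t → weylV k t := fun p =>
    ⟨p.l, mem_weylV_of_act_ne p.l.2 fun h => p.l_ne (Subtype.ext h)⟩
  let xr : Supp k t → weylV k t := fun p =>
    ⟨p.r, mem_weylV_of_act_ne p.r.2 fun h => Supp.r_ne (a := a) (b := b) p (Subtype.ext h)⟩
  let evl : ∀ p : Supp k t, (facL (k := k) t).carrier →ₗ[k] k := fun p =>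
    (Reg.eval (xl p)).toLinearMap
  let evr : ∀ p : Supp k t, (facR (k := k) t).carrier →ₗ[k] k := fun p =>
    (Reg.eval (xr p)).toLinearMap
  have hbal : ∀ (p : Supp k t) g f f', evl p ((facL (k := k) t).right g f) * evr p f' =
      evl p f * evr p ((facR (k := k) t).left g f') := by
    intro p g f f'
    have hg : ev (xl p) (inclInv k t g) = ev (xr p) (inclInv k t g) := by
      rcases p.r_eq with h | h
      · have h1 : xr p = xl p := Subtype.ext (show p.r.1 = p.l.1 from congrArg Subtype.val h)
        rw [h1]
      · have h1 : xr p = ⟨act k t (xl p), mapsTo_weylV k t (xl p).2⟩ :=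
          Subtype.ext (show p.r.1 = act k t p.l.1 from congrArg Subtype.val h)
        rw [h1]
        exact (congrArg (fun F : (RT k t).carrier => ev (xl p) F) g.2).symm
    have h1 : evl p ((facL (k := k) t).right g f) =
        ev (xl p) (inclInv k t g) * evl p f := rfl
    have h2 : evr p ((facR (k := k) t).left g f') =
        ev (xr p) (inclInv k t g) * evr p f' := rfl
    rw [h1, h2, hg]; ring
  obtain ⟨φ, hφ⟩ : ∃ φ : (bimodT k t).carrier →ₗ[k] (Supp k t → k), ∀ f f',
      φ (tmul (facL (k := k) t) (facR (k := k) t) f f') = fun p => evl p f * evr p f' :=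
    exists_tens_lift (facL (k := k) t) (facR (k := k) t) (W := Supp k t → k)
    (LinearMap.mk₂ k (fun f f' p => evl p f * evr p f')
      (fun m m' f => funext fun p => by simp [add_mul])
      (fun c m f => funext fun p => by simp [mul_assoc])
      (fun m f f' => funext fun p => by simp [mul_add])
      (fun c m f => funext fun p => by
        rw [map_smul, Pi.smul_apply, smul_eq_mul, smul_eq_mul, mul_left_comm]))
    (fun g f f' => funext fun p => hbal p g f f')
  have hval : ∀ x y p, φ ((bimodT k t).left x ((bimodT k t).right y (genT k t))) p =
      ev p.l x * ev p.r y := fun x y p => by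
    rw [left_right_genT]
    exact congrFun (hφ _ _) p
  have hl : ∀ x m p, φ ((bimodT k t).left x m) p = ev p.l x * φ m p := by
    intro x m p
    refine isGen_induction (isGen_genT t) m (by simp)
      (fun x y hx hy => by simp only [map_add, Pi.add_apply, hx, hy, mul_add]) fun y z => ?_
    rw [← Module.End.mul_apply, ← map_mul, hval, hval, map_mul, mul_assoc]
  have hr : ∀ x m p, φ ((bimodT k t).right x m) p = ev p.r x * φ m p := by
    intro x m p
    refine isGen_induction (isGen_genT t) m (by simp)
      (fun x y hx hy => by simp only [map_add, Pi.add_apply, hx, hy, mul_add]) fun y z => ?_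
    rw [← GrBimod.comm, ← Module.End.mul_apply ((bimodT k t).right x), ← map_mul, hval, hval,
      map_mul, mul_left_comm]
  have h1 : ∀ p, φ (genT k t) p = 1 := by
    intro p
    have := hval 1 1 p
    rw [map_one, map_one, map_one, map_one, mul_one] at this
    exact this
  refine ⟨φ, hl, hr, h1, ?_, ?_⟩
  · rw [injective_iff_map_eq_zero]
    intro u hu
    have hgen : LGen (bimodT k t) (genT k t) (root a b) := lGen_genT a b
    obtain ⟨c, c', rfl⟩ := hgen u
    have hz : ∀ x, actZ t x ≠ x → ev x c = 0 ∧ ev x c' = 0 := by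
      intro x hx
      obtain ⟨p, q, hp, hq, hne⟩ := Supp.sep_l x hx
      have e : ∀ p : Supp k t, ev p.l c + ev p.l c' * ev p.r (root a b) = 0 := by
        intro p
        have := congrFun hu p
        simpa only [map_add, Pi.add_apply, hl, hr, h1, mul_one, Pi.zero_apply] using this
      have e1 := e p
      have e2 := e q
      rw [hp] at e1
      rw [hq] at e2
      have h2 : ev x c' = 0 := by
        refine (mul_eq_zero.1 ?_).resolve_right (sub_ne_zero.2 hne)
        linear_combination e1 - e2
      refine ⟨?_, h2⟩
      linear_combination e1 - ev p.r (root a b) * h2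
    rw [GrBimod.comm, left_genT_eq_zero fun x hx => (hz x hx).1,
      left_genT_eq_zero fun x hx => (hz x hx).2]
    simp
  · have h := tensDeg_tmul (facL (k := k) t) (facR (k := k) t) (i := 0) (j := 0)
      (m := resL t 1) (n := resR t 1)
      (res_mem (weylV_subset k t) 0 _ (SetLike.one_mem_graded (regDeg k (weylZ k n))))
      (res_mem (weylV_subset k t) 0 _ (SetLike.one_mem_graded (regDeg k (weylZ k n))))
    rw [add_zero] at h
    exact h

end Bimodule

/-! ### The middle factor and points moved by two reflections -/

section Products

variable {k : Type u} [Field k] [CharZero k] {n : ℕ}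
  {M N : GrBimod (RBar k n) (RBar k n)} {m₀ : M.carrier} {n₀ : N.carrier}
  {T T' : Type*} {l r : T → weylZ k n} {l' r' : T' → weylZ k n} {φ : M.carrier →ₗ[k] T → k}
  {φ' : N.carrier →ₗ[k] T' → k} {s t : Perm (Fin (n + 1))}

/-- A function which vanishes at the points fixed neither by `s` nor by `t` vanishes on the
intersection of a right variety inside `V_s` and a left variety inside `V_t`. -/
theorem ev_eq_zero_of_mem_mid (h : IsModel M m₀ l r φ) (h' : IsModel N n₀ l' r' φ')
    (hs : ∀ p, actZ s (r p) ≠ r p) (ht : ∀ p, actZ t (l' p) ≠ l' p)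
    (hne : ∃ x : weylZ k n, actZ s x ≠ x ∧ actZ t x ≠ x) {f : (RBar k n).carrier}
    (hf : ∀ x, actZ s x ≠ x → actZ t x ≠ x → ev x f = 0) (y : weylZ k n)
    (hy : (y : Geom k n) ∈ M.rightVar) (hy' : (y : Geom k n) ∈ N.leftVar) : ev y f = 0 := by
  -- The origin is fixed by all reflections. It is reached as a limit along the line of some `x`
  -- moved by both, which is why `hne` is needed.
  by_cases h0 : (y : Geom k n) = 0
  · obtain ⟨x, hxs, hxt⟩ := hne
    have aux : ∀ w : Perm (Fin (n + 1)), actZ w x ≠ x → ∀ (c : k), c ≠ 0 →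
        ∀ z : weylZ k n, z.1 = c • x.1 → actZ w z ≠ z := by
      intro w hw c hc z hz hwz
      have h1 : act k w z.1 = z.1 := congrArg Subtype.val hwz
      rw [hz, map_smul] at h1
      exact hw (Subtype.ext (smul_right_injective _ hc h1))
    exact ev_eq_zero_of_forall_smul (x := x) h0 fun c hc =>
      hf _ (aux s hxs c hc _ rfl) (aux t hxt c hc _ rfl)
  -- If `s` fixed `y ≠ 0`, some function would vanish on all points moved by `s`, hence on `V_M^r`,
  -- but not at `y`. The same applies to `t` and `V_N^ℓ`.
  · refine hf y (fun hys => ?_) fun hyt => ?_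
    · obtain ⟨g, hg, hg'⟩ := exists_ev_ne_zero h0 hys
      exact hg (h.eq_zero_of_mem_rightVar (fun p => hg' _ (hs p)) y hy)
    · obtain ⟨g, hg, hg'⟩ := exists_ev_ne_zero h0 hyt
      exact hg (h'.eq_zero_of_mem_leftVar (fun p => hg' _ (ht p)) y hy')

theorem st_congr_of_forall (h : IsModel M m₀ l r φ) (h' : IsModel N n₀ l' r' φ')
    (hs : ∀ p, actZ s (r p) ≠ r p) (ht : ∀ p, actZ t (l' p) ≠ l' p)
    (hne : ∃ x : weylZ k n, actZ s x ≠ x ∧ actZ t x ≠ x) {f g : (RBar k n).carrier}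
    (hf : ∀ x, actZ s x ≠ x → actZ t x ≠ x → ev x f = ev x g) (m : M.carrier) (u : N.carrier) :
    st M N (M.right f m) u = st M N (M.right g m) u := by
  refine st_congr M N f g (fun x hx hx' => ?_) m u
  rw [← sub_eq_zero, ← map_sub]
  exact ev_eq_zero_of_mem_mid h h' hs ht hne
    (fun y hy hy' => by rw [map_sub, hf y hy hy', sub_self]) x hx hx'

/-- The points moved by both `s` and `t` serve as the dense set in `IsModel.star`, so the generators
need to be separated over these points only. -/
theorem exists_isModel_star (h : IsModel M m₀ l r φ) (h' : IsModel N n₀ l' r' φ')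
    {β β' : (RBar k n).carrier} (hM : RGen M m₀ β) (hN : LGen N n₀ β')
    (hs : ∀ p, actZ s (r p) ≠ r p) (ht : ∀ p, actZ t (l' p) ≠ l' p)
    (hne : ∃ x : weylZ k n, actZ s x ≠ x ∧ actZ t x ≠ x)
    (hr : ∀ y, actZ s y ≠ y → actZ t y ≠ y →
      ∃ p q, r p = y ∧ r q = y ∧ ev (l p) β ≠ ev (l q) β)
    (hl : ∀ y, actZ s y ≠ y → actZ t y ≠ y →
      ∃ p q, l' p = y ∧ l' q = y ∧ ev (r' p) β' ≠ ev (r' q) β') :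
    ∃ Φ, IsModel (M.star N) (st M N m₀ n₀)
      (fun p : {p : T × T' // r p.1 = l' p.2} => l p.1.1) (fun p => r' p.1.2) Φ ∧
      ∀ m u p, Φ (st M N m u) p = φ m p.1.1 * φ' u p.1.2 :=
  h.star h' hM hN {y | actZ s y ≠ y ∧ actZ t y ≠ y}
    (fun _ hf => ev_eq_zero_of_mem_mid h h' hs ht hne fun x hx hx' => hf x ⟨hx, hx'⟩)
    (fun y hy => hr y hy.1 hy.2) (fun y hy => hl y hy.1 hy.2)

end Products

/-! ### Products of two bimodules: equal and commuting reflections -/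

section Pairs

variable {k : Type u} [Field k] [CharZero k] {n : ℕ}

/-- The two summands are generated by `1 ⊗ 1 ⊗ 1` and `1 ⊗ α ⊗ 1`. They give the whole product since
every middle function is `f₀ + α f₁` with invariants `f₀`, `f₁` that move out to the left. -/
theorem star_self_isomorphic_of_isModel {a b : Fin (n + 1)} (hab : a ≠ b)
    {B : GrBimod (RBar k n) (RBar k n)} {m₀ : B.carrier}
    {φ : B.carrier →ₗ[k] Supp k (swap a b) → k} (hφ : IsModel B m₀ Supp.l Supp.r φ)
    (hgen : B.IsGen m₀) (hR : RGen B m₀ (root a b)) (hL : LGen B m₀ (root a b))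
    (hinv : ∀ f, IsInv (swap a b) f → B.left f m₀ = B.right f m₀) :
    (B.star B).Isomorphic (B.directSum (B.shift (-2))) := by
  have hne : ∃ x : weylZ k n, actZ (swap a b) x ≠ x ∧ actZ (swap a b) x ≠ x := by
    obtain ⟨x, hx⟩ := exists_mem_weylZ (k := k) {a} (Finset.mem_singleton_self a)
      (Finset.notMem_singleton.2 hab.symm)
    have : actZ (swap a b) x ≠ x := by
      rw [Ne, actZ_swap_eq_iff, hx]
      simp [hab.symm]
    exact ⟨x, this, this⟩
  obtain ⟨Φ, hΦ, hΦv⟩ := exists_isModel_star hφ hφ hR hL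
    (fun p => p.r_ne) (fun p => p.l_ne) hne (fun y hy _ => Supp.sep_r y hy)
    (fun y hy _ => Supp.sep_l y hy)
  set E := st B B m₀ m₀ with hEdef
  set E' := st B B m₀ (B.left (root a b) m₀) with hEdef'
  have hE : E ∈ (B.star B).deg 0 := hΦ.gen_mem
  have hE' : E' ∈ (B.star B).deg 2 := by
    simpa using st_mem B B hφ.gen_mem (B.left_mem (root_mem a b) hφ.gen_mem)
  have hΦE : ∀ p, Φ E p = 1 := hΦ.gen
  have hΦE' : ∀ p, Φ E' p = ev p.1.2.l (root a b) := fun p => by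
    rw [hEdef', hΦv, hφ.left, hφ.gen, hφ.gen, one_mul, mul_one]
  -- Composites of points of the support stay in the support, so the relations of `m₀` hold for
  -- every element of the product.
  have hker : ∀ (u : (B.star B).carrier) τ, B.orb m₀ τ = 0 → (B.star B).orb u τ = 0 := by
    intro u τ hτ
    refine hΦ.inj (funext fun p => ?_)
    obtain ⟨w, hw, hw'⟩ := Supp.exists_comp p.1.1 p.1.2 p.2
    rw [hΦ.map_orb, ← hw, ← hw', (hφ.orb_eq_zero τ).1 hτ w, zero_mul, map_zero]; rfl
  obtain ⟨g, hg, hgl, hgr, hgd⟩ := exists_hom_of_isGen hgen hφ.gen_mem hE (hker E)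
  obtain ⟨g', hg', hgl', hgr', hgd'⟩ := exists_hom_of_isGen hgen hφ.gen_mem hE' (hker E')
  have hgm : g m₀ = E := by
    have := hg (1 ⊗ₜ 1)
    simpa using this
  have hgm' : g' m₀ = E' := by
    have := hg' (1 ⊗ₜ 1)
    simpa using this
  refine (isomorphic_of_bijective (M := B.directSum (B.shift (-2))) (g.coprod g') ⟨?_, ?_⟩
    ?_ ?_ ?_).symm
  · have hinj : ∀ x y, g x + g' y = 0 → x = 0 ∧ y = 0 := by
      intro x y hxy
      obtain ⟨τ, rfl⟩ := hgen x
      obtain ⟨σ, rfl⟩ := hgen y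
      rw [hg, hg'] at hxy
      have key : ∀ w : Supp k (swap a b), evalPair w.l w.r τ = 0 ∧ evalPair w.l w.r σ = 0 := by
        intro w
        -- A point `w` of the support factors through both possible middle points, `w.l` and its
        -- reflection. The root differs there, which separates the two summands.
        have e : ∀ y : weylZ k n, (y = w.l ∨ y = actZ (swap a b) w.l) →
            evalPair w.l w.r τ + evalPair w.l w.r σ * ev y (root a b) = 0 := by
          intro y hy
          obtain ⟨p, hp, hp'⟩ := exists_supp w.l_ne hy
          have hyne : actZ (swap a b) y ≠ y := hp' ▸ p.r_ne
          obtain ⟨q, hq, hq'⟩ := exists_supp (y := w.r) hyne (by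
            rcases hy with rfl | rfl <;> rcases w.r_eq with h | h <;> simp [h, actZ_actZ_swap])
          have h1 := congrFun (congrArg Φ hxy) ⟨(p, q), hp'.trans hq.symm⟩
          rw [map_add, Pi.add_apply, hΦ.map_orb, hΦ.map_orb, hΦE, hΦE', mul_one] at h1
          simp only [hp, hq', hq, map_zero, Pi.zero_apply] at h1
          exact h1
        have e1 := e _ (Or.inl rfl)
        have e2 := e _ (Or.inr rfl)
        have h2 : evalPair w.l w.r σ = 0 := by
          refine (mul_eq_zero.1 ?_).resolve_right (sub_ne_zero.2 (ev_root_ne w.l_ne))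
          linear_combination e1 - e2
        refine ⟨?_, h2⟩
        linear_combination e1 - ev w.l (root a b) * h2
      exact ⟨(hφ.orb_eq_zero _).2 fun w => (key w).1, (hφ.orb_eq_zero _).2 fun w => (key w).2⟩
    refine (injective_iff_map_eq_zero (g.coprod g')).2 ?_
    rintro ⟨x, y⟩ hxy
    obtain ⟨rfl, rfl⟩ := hinj x y hxy
    rfl
  · intro u
    refine star_mem_of_isGen hgen hgen (S := LinearMap.range (g.coprod g')) ?_ ?_ (fun f => ?_) u
    · rintro x _ ⟨⟨y, z⟩, rfl⟩
      refine ⟨(B.left x y, B.left x z), ?_⟩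
      simp only [LinearMap.coprod_apply, hgl, hgl', map_add]
    · rintro x _ ⟨⟨y, z⟩, rfl⟩
      refine ⟨(B.right x y, B.right x z), ?_⟩
      simp only [LinearMap.coprod_apply, hgr, hgr', map_add]
    · obtain ⟨f₀, f₁, h₀, h₁, rfl⟩ := exists_inv_decomp a b f
      refine ⟨(B.left f₀ m₀, B.left f₁ m₀), ?_⟩
      rw [LinearMap.coprod_apply, hgl, hgl', hgm, hgm', hEdef, hEdef', left_st, left_st,
        ← st_balanced, hinv _ h₀, hinv _ h₁, map_add, map_mul,
        LinearMap.add_apply, Module.End.mul_apply, map_add, LinearMap.add_apply]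
  · rintro x ⟨y, (z : B.carrier)⟩
    change g (B.left x y) + g' (B.left x z) = (B.star B).left x (g y + g' z)
    rw [hgl, hgl', map_add]
  · rintro x ⟨y, (z : B.carrier)⟩
    change g (B.right x y) + g' (B.right x z) = (B.star B).right x (g y + g' z)
    rw [hgr, hgr', map_add]
  · rintro d ⟨y, z⟩ ⟨hy, hz⟩
    have h1 := hgd d y hy
    have h2 := hgd' (d + -2) z hz
    rw [add_zero] at h1
    rw [neg_add_cancel_right] at h2
    exact add_mem h1 h2

/-- `B_s ∗ B_s ≅ B_s ⊕ B_s[-2]`. -/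
theorem star_self_isomorphic {a b : Fin (n + 1)} (hab : a ≠ b) :
    ((bimodT k (swap a b)).star (bimodT k (swap a b))).Isomorphic
      ((bimodT k (swap a b)).directSum ((bimodT k (swap a b)).shift (-2))) := by
  obtain ⟨φ, hφ⟩ := exists_isModel_bimodT (k := k) a b
  exact star_self_isomorphic_of_isModel hab hφ (isGen_genT _) (rGen_genT a b) (lGen_genT a b)
    fun _ => left_genT_of_isInv

/-! ### Commuting reflections -/

theorem exists_isModel_star_of_disjoint {a b c d : Fin (n + 1)} (hab : a ≠ b) (hac : a ≠ c)
    (had : a ≠ d) (hbc : b ≠ c) (hbd : b ≠ d) (hcd : c ≠ d) :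
    ∃ Φ, IsModel ((bimodT k (swap a b)).star (bimodT k (swap c d)))
      (st _ _ (genT k (swap a b)) (genT k (swap c d)))
      (T := {p : Supp k (swap a b) × Supp k (swap c d) // p.1.r = p.2.l})
      (fun p => p.1.1.l) (fun p => p.1.2.r) Φ ∧
      ((bimodT k (swap a b)).star (bimodT k (swap c d))).IsGen
        (st _ _ (genT k (swap a b)) (genT k (swap c d))) := by
  obtain ⟨φ, hφ⟩ := exists_isModel_bimodT (k := k) a b
  obtain ⟨φ', hφ'⟩ := exists_isModel_bimodT (k := k) c d
  have hne : ∃ x : weylZ k n, actZ (swap a b) x ≠ x ∧ actZ (swap c d) x ≠ x := by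
    -- The set `{a, c}` separates `a` from `b` and `c` from `d`, so both reflections move the point.
    obtain ⟨x, hx⟩ := exists_mem_weylZ (k := k) {a, c} (p := a) (q := b) (by simp)
      (by simp [hab.symm, hbc])
    refine ⟨x, ?_, ?_⟩
    · rw [Ne, actZ_swap_eq_iff, hx]; simp [hab.symm, hbc]
    · rw [Ne, actZ_swap_eq_iff, hx]; simp [had.symm, hcd.symm]
  obtain ⟨Φ, hΦ, -⟩ := exists_isModel_star hφ hφ' (rGen_genT a b) (lGen_genT c d)
    (fun p => p.r_ne) (fun p => p.l_ne) hne (fun y hy _ => Supp.sep_r y hy)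
    (fun y _ hy => Supp.sep_l y hy)
  refine ⟨Φ, hΦ, IsGen.star (isGen_genT _) (isGen_genT _) fun f => ?_⟩
  obtain ⟨f₀, f₁, h₀, h₁, rfl⟩ := exists_inv_decomp a b f
  have hinv : IsInv (swap c d) (root (k := k) a b) := by
    intro x
    rw [ev_root, ev_root, actZ_swap_apply, actZ_swap_apply, swap_apply_of_ne_of_ne hac had,
      swap_apply_of_ne_of_ne hbc hbd]
  -- The invariants of `(a b)` leave the middle to the left, the root to the right, being invariant
  -- under `(c d)`.
  refine ⟨f₀ ⊗ₜ 1 + f₁ ⊗ₜ root a b, ?_⟩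
  rw [map_add, orb_tmul, orb_tmul, map_one, Module.End.one_apply, right_st, left_st, left_st,
    map_add, LinearMap.add_apply, map_mul, Module.End.mul_apply, map_add, LinearMap.add_apply,
    st_balanced _ _ (root a b), ← left_genT_of_isInv h₀, ← left_genT_of_isInv h₁,
    left_genT_of_isInv hinv]

/-- `B_s ∗ B_t ≅ B_t ∗ B_s` if `s` and `t` have disjoint supports. -/
theorem star_comm_isomorphic {a b c d : Fin (n + 1)} (hab : a ≠ b) (hac : a ≠ c)
    (had : a ≠ d) (hbc : b ≠ c) (hbd : b ≠ d) (hcd : c ≠ d) :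
    ((bimodT k (swap a b)).star (bimodT k (swap c d))).Isomorphic
      ((bimodT k (swap c d)).star (bimodT k (swap a b))) := by
  obtain ⟨Φ, hΦ, hg⟩ := exists_isModel_star_of_disjoint (k := k) hab hac had hbc hbd hcd
  obtain ⟨Ψ, hΨ, hg'⟩ :=
    exists_isModel_star_of_disjoint (k := k) hcd hac.symm hbc.symm had.symm hbd.symm hab
  have hcomm : ∀ x : weylZ k n,
      actZ (swap a b) (actZ (swap c d) x) = actZ (swap c d) (actZ (swap a b) x) := by
    intro x
    refine Subtype.ext ?_
    change act k _ (act k _ x.1) = act k _ (act k _ x.1)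
    rw [← act_mul, ← act_mul]
    congr 2
    exact Equiv.Perm.Disjoint.commute
      (Equiv.Perm.disjoint_swap_swap (by simp [hab, hac, had, hbc, hbd, hcd]))
  -- A step along `s` followed by one along `t` can be made in the opposite order. Since `s` and `t`
  -- commute, the new intermediate point is still moved by the required reflection.
  have key : ∀ {s t : Perm (Fin (n + 1))},
      (∀ x : weylZ k n, actZ s (actZ t x) = actZ t (actZ s x)) →
      (∀ x : weylZ k n, actZ t (actZ t x) = x) →
      ∀ p : {p : Supp k s × Supp k t // p.1.r = p.2.l},
      ∃ q : {p : Supp k t × Supp k s // p.1.r = p.2.l}, q.1.1.l = p.1.1.l ∧ q.1.2.r = p.1.2.r := by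
    rintro s t hst ht' ⟨⟨p, q⟩, h⟩
    have hq : actZ t p.r ≠ p.r := by
      have := q.l_ne
      rwa [← h] at this
    have ht : actZ t p.l ≠ p.l := by
      rcases p.r_eq with h1 | h1
      · rwa [h1] at hq
      · rw [h1, ← hst] at hq
        exact fun h' => hq (by rw [h'])
    rcases q.r_eq with h2 | h2
    · obtain ⟨q', e1, e2⟩ := exists_supp ht (Or.inl rfl)
      exact ⟨⟨(q', p), e2⟩, e1, by rw [h2]; exact h⟩
    · obtain ⟨q', e1, e2⟩ := exists_supp ht (Or.inr rfl)
      have h3 : actZ s (actZ t p.l) ≠ actZ t p.l := by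
        rw [hst]
        exact fun h' => p.l_ne (Function.LeftInverse.injective ht' h')
      obtain ⟨p', e3, e4⟩ := exists_supp (y := q.r) h3 (by
        rw [h2, ← show p.r = q.l from h]
        rcases p.r_eq with h1 | h1 <;> rw [h1]
        · exact Or.inl rfl
        · rw [hst]; exact Or.inr rfl)
      exact ⟨⟨(q', p'), e2.trans e3.symm⟩, e1, e4⟩
  exact hΦ.isomorphic hΨ hg hg' (key hcomm (actZ_actZ_swap c d))
    (key (fun x => (hcomm x).symm) (actZ_actZ_swap a b))

end Pairs

/-! ### Adjacent reflections `(a b)` and `(c b)` -/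

section Adjacent

variable {k : Type u} [Field k] {n : ℕ} {a b c : Fin (n + 1)}

/-- If `(c b)` fixes `x`, then `x_c = x_b ≠ x_a`; after exchanging the entries at `a` and `b`, the
entries at `c` and `b` differ. -/
theorem exists_actZ_ne (hac : a ≠ c) (hbc : b ≠ c) {x : weylZ k n} (ha : actZ (swap a b) x ≠ x) :
    ∃ y, (y = x ∨ y = actZ (swap a b) x) ∧ actZ (swap a b) y ≠ y ∧ actZ (swap c b) y ≠ y := by
  by_cases hc : actZ (swap c b) x = x
  · refine ⟨_, Or.inr rfl, actZ_swap_ne ha, fun h => ha ?_⟩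
    rw [actZ_swap_eq_iff] at hc
    rw [actZ_swap_eq_iff, actZ_swap_apply, actZ_swap_apply, swap_apply_right,
      swap_apply_of_ne_of_ne hac.symm hbc.symm] at h
    rw [actZ_swap_eq_iff, ← h, hc]
  · exact ⟨x, Or.inl rfl, ha, hc⟩

/-- The path stays put in the middle: `v.l → y → y → v.r`, where `y` is the one of `v.l` and its
reflection provided by `exists_actZ_ne`. -/
theorem Supp.exists_decomp₃ (hac : a ≠ c) (hbc : b ≠ c) (v : Supp k (swap a b)) :
    ∃ (p w : Supp k (swap a b)) (q : Supp k (swap c b)), p.r = q.l ∧ q.r = w.l ∧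
      p.l = v.l ∧ w.r = v.r := by
  obtain ⟨y, hy, hs, ht⟩ := exists_actZ_ne hac hbc v.l_ne
  obtain ⟨p, hp, hp'⟩ := exists_supp v.l_ne hy
  obtain ⟨q, hq, hq'⟩ := exists_supp ht (Or.inl rfl)
  obtain ⟨w, hw, hw'⟩ := exists_supp (y := v.r) hs (by
    rcases hy with rfl | rfl <;> rcases v.r_eq with h | h <;> simp [h, actZ_actZ_swap])
  exact ⟨p, w, q, hp'.trans hq.symm, hq'.trans hw.symm, hp, hw'⟩

variable [CharZero k]

/-- Only two values are available, and both `x_a` and `x_c` differ from `x_b`. All special features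
of the adjacent case come from this. -/
theorem apply_eq_of_actZ_ne {x : weylZ k n} (ha : actZ (swap a b) x ≠ x)
    (hc : actZ (swap c b) x ≠ x) : x.1.1 a = x.1.1 c := by
  rw [Ne, actZ_swap_eq_iff] at ha hc
  rcases weylZ_apply_eq x.2 a b c with h | h | h
  · exact absurd h ha
  · exact absurd h.symm hc
  · exact h

theorem actZ_actZ_eq (hac : a ≠ c) (hbc : b ≠ c) {x : weylZ k n} (ha : actZ (swap a b) x ≠ x)
    (hc : actZ (swap c b) x ≠ x) : actZ (swap c b) (actZ (swap a b) x) = actZ (swap a b) x := by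
  rw [actZ_swap_eq_iff, actZ_swap_apply, actZ_swap_apply, swap_apply_right,
    swap_apply_of_ne_of_ne hac.symm hbc.symm, apply_eq_of_actZ_ne ha hc]

/-- Restricted to `V_s ∩ V_t`, every function is the restriction of an `s`-invariant function. -/
theorem exists_isInv_eq (hac : a ≠ c) (hbc : b ≠ c) (f : (RBar k n).carrier) :
    ∃ g, IsInv (swap a b) g ∧
      ∀ x, actZ (swap a b) x ≠ x → actZ (swap c b) x ≠ x → ev x f = ev x g := by
  obtain ⟨f₀, f₁, h₀, h₁, rfl⟩ := exists_inv_decomp a b f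
  -- Where `x_a = x_c`, the root `x_a - x_b` equals `2 x_c - (x_a + x_b)`, which is invariant under
  -- `(a b)`.
  refine ⟨f₀ + (coord c + coord c - (coord a + coord b)) * f₁, h₀.add (IsInv.mul (fun x => ?_) h₁),
    fun x ha hc => ?_⟩
  · simp only [map_add, map_sub, ev_coord, actZ_swap_apply, swap_apply_left, swap_apply_right,
      swap_apply_of_ne_of_ne hac.symm hbc.symm]
    ring
  · simp only [map_add, map_sub, map_mul, ev_coord, ev_root, apply_eq_of_actZ_ne ha hc]
    ring

theorem exists_actZ_ne_actZ_ne (hab : a ≠ b) (hbc : b ≠ c) :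
    ∃ x : weylZ k n, actZ (swap a b) x ≠ x ∧ actZ (swap c b) x ≠ x := by
  obtain ⟨x, hx⟩ := exists_mem_weylZ (k := k) {b} (Finset.mem_singleton_self b)
    (Finset.notMem_singleton.2 hab)
  refine ⟨x, ?_, ?_⟩
  · rw [Ne, actZ_swap_eq_iff, hx]; simp [hab]
  · rw [Ne, actZ_swap_eq_iff, hx]; simp [hbc.symm]

/-- The middle step cannot be `(c b)`: its start is moved by both reflections, so its end would be
fixed by `(a b)`, yet that end is the start of `w`. The middle step is thus trivial and the outer
two compose. -/
theorem Supp.exists_comp₃ (hac : a ≠ c) (hab : a ≠ b) (p w : Supp k (swap a b))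
    (q : Supp k (swap c b)) (h : p.r = q.l) (h' : q.r = w.l) :
    ∃ v : Supp k (swap a b), v.l = p.l ∧ v.r = w.r := by
  refine Supp.exists_comp p w ?_
  rcases q.r_eq with h1 | h1
  · rw [h, ← h1, h']
  · have h2 := p.r_ne
    rw [h] at h2
    have h3 := w.l_ne
    rw [← h', h1] at h3
    exact absurd (actZ_actZ_eq hac.symm hab.symm q.l_ne h2) h3

/-- The generator of `B_s ∗ B_t`. -/
abbrev genStar (s t : Perm (Fin (n + 1))) : ((bimodT k s).star (bimodT k t)).carrier :=
  st (bimodT k s) (bimodT k t) (genT k s) (genT k t)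

theorem exists_isModel_star_of_adjacent (hab : a ≠ b) (hbc : b ≠ c) :
    ∃ Φ, IsModel ((bimodT k (swap a b)).star (bimodT k (swap c b)))
      (genStar (swap a b) (swap c b))
      (T := {p : Supp k (swap a b) × Supp k (swap c b) // p.1.r = p.2.l})
      (fun p => p.1.1.l) (fun p => p.1.2.r) Φ := by
  obtain ⟨φ, hφ⟩ := exists_isModel_bimodT (k := k) a b
  obtain ⟨φ', hφ'⟩ := exists_isModel_bimodT (k := k) c b
  obtain ⟨Φ, hΦ, -⟩ := exists_isModel_star hφ hφ' (rGen_genT a b) (lGen_genT c b)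
    (fun p => p.r_ne) (fun p => p.l_ne) (exists_actZ_ne_actZ_ne hab hbc)
    (fun y hy _ => Supp.sep_r y hy) (fun y _ hy => Supp.sep_l y hy)
  exact ⟨Φ, hΦ⟩

theorem st_congr_of_adjacent (hab : a ≠ b) (hbc : b ≠ c) {f g : (RBar k n).carrier}
    (hf : ∀ x, actZ (swap a b) x ≠ x → actZ (swap c b) x ≠ x → ev x f = ev x g)
    (m : (bimodT k (swap a b)).carrier) (u : (bimodT k (swap c b)).carrier) :
    st _ _ ((bimodT k (swap a b)).right f m) u = st _ _ ((bimodT k (swap a b)).right g m) u := by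
  obtain ⟨φ, hφ⟩ := exists_isModel_bimodT (k := k) a b
  obtain ⟨φ', hφ'⟩ := exists_isModel_bimodT (k := k) c b
  exact st_congr_of_forall hφ hφ' (fun p => p.r_ne) (fun p => p.l_ne)
    (exists_actZ_ne_actZ_ne hab hbc) hf m u

/-- A middle function counts only at points moved by both reflections, where it may be replaced by
one invariant under `(a b)`, and this one passes through the first factor. -/
theorem st_right_eq_left (hab : a ≠ b) (hac : a ≠ c) (hbc : b ≠ c) (f : (RBar k n).carrier) :
    ∃ g, ∀ u, st (bimodT k (swap a b)) (bimodT k (swap c b))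
        ((bimodT k (swap a b)).right f (genT k (swap a b))) u =
      st _ _ ((bimodT k (swap a b)).left g (genT k (swap a b))) u := by
  obtain ⟨g, hg, hfg⟩ := exists_isInv_eq (c := c) hac hbc f
  exact ⟨g, fun u => by rw [st_congr_of_adjacent hab hbc hfg, left_genT_of_isInv hg]⟩

theorem st_left_eq_right (hab : a ≠ b) (hac : a ≠ c) (hbc : b ≠ c) (f : (RBar k n).carrier) :
    ∃ g, ∀ m, st (bimodT k (swap a b)) (bimodT k (swap c b)) m
        ((bimodT k (swap c b)).left f (genT k (swap c b))) =
      st _ _ m ((bimodT k (swap c b)).right g (genT k (swap c b))) := by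
  obtain ⟨g, hg, hfg⟩ := exists_isInv_eq (c := a) hac.symm hab.symm f
  exact ⟨g, fun m => by
    rw [← st_balanced, st_congr_of_adjacent hab hbc fun x ha hc => hfg x hc ha, st_balanced,
      left_genT_of_isInv hg]⟩

theorem isGen_star_of_adjacent (hab : a ≠ b) (hac : a ≠ c) (hbc : b ≠ c) :
    ((bimodT k (swap a b)).star (bimodT k (swap c b))).IsGen
      (genStar (swap a b) (swap c b)) :=
  IsGen.star_of_left (isGen_genT _) (isGen_genT _) fun f => by
    obtain ⟨g, hg⟩ := st_right_eq_left hab hac hbc f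
    exact ⟨g, hg _⟩

/-- The coefficients in `left_genT` first move to the middle and then, by `st_left_eq_right`,
through the second factor. These two generators allow the product with a third factor to be treated
by `IsModel.star`. -/
theorem rGen_star_of_adjacent (hab : a ≠ b) (hac : a ≠ c) (hbc : b ≠ c) :
    RGen ((bimodT k (swap a b)).star (bimodT k (swap c b))) (genStar (swap a b) (swap c b))
      (root a b) :=
  RGen.of_left (isGen_star_of_adjacent hab hac hbc) fun f => by
    obtain ⟨x, x', -, -, h⟩ := left_genT (k := k) a b f
    obtain ⟨g, hg⟩ := st_left_eq_right (k := k) hab hac hbc x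
    obtain ⟨g', hg'⟩ := st_left_eq_right (k := k) hab hac hbc x'
    refine ⟨g, g', ?_⟩
    rw [left_st, h, map_add, LinearMap.add_apply, st_balanced, st_balanced, hg, hg', left_st,
      right_st, right_st]

theorem lGen_star_of_adjacent (hab : a ≠ b) (hac : a ≠ c) (hbc : b ≠ c) :
    LGen ((bimodT k (swap a b)).star (bimodT k (swap c b))) (genStar (swap a b) (swap c b))
      (root c b) :=
  LGen.of_right (isGen_star_of_adjacent hab hac hbc) fun f => by
    obtain ⟨x, x', -, -, h⟩ := right_genT (k := k) c b f
    obtain ⟨g, hg⟩ := st_right_eq_left (k := k) hab hac hbc x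
    obtain ⟨g', hg'⟩ := st_right_eq_left (k := k) hab hac hbc x'
    refine ⟨g, g', ?_⟩
    rw [right_st, h, map_add, ← st_balanced, ← st_balanced, hg, hg', left_st, right_st, left_st]

/-- `(B_s ∗ B_t) ∗ B_s ≅ B_s` for adjacent `s` and `t`. -/
theorem star_star_isomorphic_left (hab : a ≠ b) (hac : a ≠ c) (hbc : b ≠ c) :
    (((bimodT k (swap a b)).star (bimodT k (swap c b))).star (bimodT k (swap a b))).Isomorphic
      (bimodT k (swap a b)) := by
  obtain ⟨φ, hφ⟩ := exists_isModel_bimodT (k := k) a b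
  obtain ⟨Φ, hΦ⟩ := exists_isModel_star_of_adjacent (k := k) hab hbc
  have hne : ∃ x : weylZ k n, actZ (swap c b) x ≠ x ∧ actZ (swap a b) x ≠ x := by
    obtain ⟨x, h, h'⟩ := exists_actZ_ne_actZ_ne (k := k) hab hbc
    exact ⟨x, h', h⟩
  obtain ⟨Ψ, hΨ, -⟩ := exists_isModel_star hΦ hφ (rGen_star_of_adjacent hab hac hbc)
    (lGen_genT a b) (fun p => p.1.2.r_ne) (fun p => p.l_ne) hne (fun y ht hs => by
      obtain ⟨p, q, hp, hq, hpq⟩ := Supp.sep_r y hs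
      obtain ⟨w, hw, hw'⟩ := exists_supp ht (Or.inl rfl)
      -- The points over `y` are chosen with a diagonal second component, so the separation is that
      -- of the first factor.
      exact ⟨⟨(p, w), hp.trans hw.symm⟩, ⟨(q, w), hq.trans hw.symm⟩, hw', hw', hpq⟩)
    (fun y _ hy => Supp.sep_l y hy)
  refine hΨ.isomorphic hφ (IsGen.star_of_right (isGen_star_of_adjacent hab hac hbc)
    (isGen_genT _) fun f => ?_) (isGen_genT _) ?_ ?_
  · obtain ⟨g, hg, hfg⟩ := exists_isInv_eq (c := c) hac hbc f
    refine ⟨g, ?_⟩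
    rw [← left_genT_of_isInv hg, ← st_balanced, ← st_balanced]
    exact st_congr_of_forall hΦ hφ (fun p => p.1.2.r_ne) (fun p => p.l_ne) hne
      (fun x hc ha => hfg x ha hc) _ _
  · rintro ⟨⟨⟨⟨p, q⟩, h⟩, w⟩, h'⟩
    exact Supp.exists_comp₃ hac hab p w q h h'
  · intro v
    obtain ⟨p, w, q, h, h', e, e'⟩ := Supp.exists_decomp₃ hac hbc v
    exact ⟨⟨⟨⟨(p, q), h⟩, w⟩, h'⟩, e, e'⟩

/-- `B_s ∗ (B_t ∗ B_s) ≅ B_s` for adjacent `s` and `t`. -/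
theorem star_star_isomorphic_right (hab : a ≠ b) (hac : a ≠ c) (hbc : b ≠ c) :
    ((bimodT k (swap a b)).star ((bimodT k (swap c b)).star (bimodT k (swap a b)))).Isomorphic
      (bimodT k (swap a b)) := by
  obtain ⟨φ, hφ⟩ := exists_isModel_bimodT (k := k) a b
  obtain ⟨Φ, hΦ⟩ := exists_isModel_star_of_adjacent (k := k) hbc.symm hab.symm
  have hne := exists_actZ_ne_actZ_ne (k := k) hab hbc
  obtain ⟨Ψ, hΨ, -⟩ := exists_isModel_star hφ hΦ (rGen_genT a b)
    (lGen_star_of_adjacent hbc.symm hac.symm hab.symm) (fun p => p.r_ne) (fun p => p.1.1.l_ne) hne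
    (fun y hy _ => Supp.sep_r y hy) (fun y hs ht => by
      obtain ⟨p, q, hp, hq, hpq⟩ := Supp.sep_l y hs
      obtain ⟨w, hw, hw'⟩ := exists_supp ht (Or.inl rfl)
      exact ⟨⟨(w, p), hw'.trans hp.symm⟩, ⟨(w, q), hw'.trans hq.symm⟩, hw, hw, hpq⟩)
  refine hΨ.isomorphic hφ (IsGen.star_of_left (isGen_genT _)
    (isGen_star_of_adjacent hbc.symm hac.symm hab.symm) fun f => ?_) (isGen_genT _) ?_ ?_
  · obtain ⟨g, hg, hfg⟩ := exists_isInv_eq (c := c) hac hbc f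
    refine ⟨g, ?_⟩
    rw [left_genT_of_isInv hg]
    exact st_congr_of_forall hφ hΦ (fun p => p.r_ne) (fun p => p.1.1.l_ne) hne hfg _ _
  · rintro ⟨⟨p, ⟨⟨q, w⟩, h⟩⟩, h'⟩
    exact Supp.exists_comp₃ hac hab p w q h' h
  · intro v
    obtain ⟨p, w, q, h, h', e, e'⟩ := Supp.exists_decomp₃ hac hbc v
    exact ⟨⟨⟨p, ⟨(q, w), h'⟩⟩, h⟩, e, e'⟩

end Adjacent

end TLBimod

end

theorem mainTheorem3 (k : Type*) [Field k] [CharZero k] (n : ℕ) :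
    (∀ i j : Fin n, |(i : ℤ) - (j : ℤ)| = 1 →
      (((TLBimod.bimodB k j).star (TLBimod.bimodB k i)).star (TLBimod.bimodB k j)).Isomorphic
          (TLBimod.bimodB k j) ∧
        ((TLBimod.bimodB k j).star ((TLBimod.bimodB k i).star (TLBimod.bimodB k j))).Isomorphic
          (TLBimod.bimodB k j)) ∧
    (∀ i j : Fin n, 1 < |(i : ℤ) - (j : ℤ)| →
      ((TLBimod.bimodB k i).star (TLBimod.bimodB k j)).Isomorphic
        ((TLBimod.bimodB k j).star (TLBimod.bimodB k i))) ∧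
    (∀ i : Fin n,
      ((TLBimod.bimodB k i).star (TLBimod.bimodB k i)).Isomorphic
        ((TLBimod.bimodB k i).directSum ((TLBimod.bimodB k i).shift (-2)))) := by
  have hne : ∀ {x y : Fin (n + 1)}, (x : ℕ) ≠ y → x ≠ y := fun h e => h (congrArg _ e)
  refine ⟨fun i j hij => ?_, fun i j hij => ?_, fun i => ?_⟩
  · unfold TLBimod.bimodB
    rcases (abs_eq zero_le_one).1 hij with h | h
    · have e : i.castSucc = j.succ := Fin.ext (by simp; omega)
      -- The adjacent case requires the shared letter as second entry of both transpositions; here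
      -- it is `j.succ`, in the other case `j.castSucc`.
      rw [e, Equiv.swap_comm j.succ i.succ]
      have h1 : j.castSucc ≠ j.succ := hne (by simp)
      have h2 : j.castSucc ≠ i.succ := hne (by simp; omega)
      have h3 : j.succ ≠ i.succ := hne (by simp; omega)
      exact ⟨TLBimod.star_star_isomorphic_left h1 h2 h3,
        TLBimod.star_star_isomorphic_right h1 h2 h3⟩
    · have e : i.succ = j.castSucc := Fin.ext (by simp; omega)
      rw [e, Equiv.swap_comm j.castSucc j.succ]
      have h1 : j.succ ≠ j.castSucc := hne (by simp)
      have h2 : j.succ ≠ i.castSucc := hne (by simp; omega)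
      have h3 : j.castSucc ≠ i.castSucc := hne (by simp; omega)
      exact ⟨TLBimod.star_star_isomorphic_left h1 h2 h3,
        TLBimod.star_star_isomorphic_right h1 h2 h3⟩
  · have h : (i : ℕ) + 1 < j ∨ (j : ℕ) + 1 < i := by
      rcases lt_abs.1 hij with h | h <;> omega
    refine TLBimod.star_comm_isomorphic ?_ ?_ ?_ ?_ ?_ ?_ <;>
      exact hne (by simp only [Fin.val_castSucc, Fin.val_succ]; omega)
  · exact TLBimod.star_self_isomorphic (hne (by simp))
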